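/- **Setting.** A program has program points $\mathcal N$ with start point $u_0$, local variables $\mathcal X\ni\mathsf{self}$, globals $\mathcal G$, a finite set $\mathsf M$ of mutexes, and control-flow edges $(u,A,v)$ whose actions are guards/computations on locals, $x=\mathsf{create}(u_1)$, $\mathsf{lock}(a)$, $\mathsf{unlock}(a)$, $g=x$ and $x=g$. Each global $g$ has its own dedicated mutex $m_g$; accesses are atomic: each access $A$ to $g$ occurs as $\mathsf{lock}(m_g);A;\mathsf{unlock}(m_g)$, and $m_g$ is acquired only immediately before an access to $g$. Call $S\subseteq\mathsf M$ *appropriate* for $u$ if $(u,S)$ is obtained from $(u_0,\emptyset)$ by following control-flow edges, where $\mathsf{lock}(a)$ requires $a\notin S$ and leads to $S\cup\{a\}$, $\mathsf{unlock}(a)$ requires $a\in S$ and leads to $S\setminus\{a\}$, all other actions keep $S$, and $x=\mathsf{create}(u_1)$ additionally yields $(u_1,\emptyset)$. For each $g$ a set $\mathcal M[g]\ni m_g$ is given with $\mathcal M[g]\subseteq S$ for every edge $(u,g=x,v)$ and every $S$ appropriate for $u$. $\mathcal D$ is a complete lattice. Stores are maps $\sigma:\mathcal X\cup\mathcal G\to\mathcal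 D$. A constraint $x\sqsupseteq f_x$ maps an assignment $\eta$ of values to unknowns to a collection of side-effects $y\mapsto d$ and a value $d_x$; $\eta$ is a (post-)solution if always $d\sqsubseteq\eta\,y$ and $d_x\sqsubseteq\eta\,x$. In the systems below there is, for each edge $(u,A,v)$ and each $S$ appropriate for $u$ at which $A$ is allowed, one constraint for $[v,S']$, where $S'$ is the lockset after $A$. Guards and local computations act on the locals in $\sigma$ by given monotone functions, the same in all systems. Unmentioned components are unchanged and unmentioned side-effects absent. **$\mathcal C_1$ (Protection-Based Reading).** Unknowns $[u,S]$ with values $(P,\sigma)$, $P\subseteq\mathcal G$ ordered by $\supseteq$, and $[g],[g]'$ with values in $\mathcal D$. Initially $[u_0,\emptyset]\sqsupseteq(\emptyset,\sigma_0)$ with $\sigma_0\,x=\top$, $\sigma_0\,g=\bot$. Let $(P,\sigma)=\eta[u,S]$. - $x=\mathsf{create}(u_1)$: with $i=\nu_1\,u\,(P,\sigma)\,u_1$ ($\nu_1$ monotone in the state), set $x$ to $i$; side-effect $[u_1,\emptyset]\mapsto(\emptyset,\sigma\oplus(\{\mathsf{self}\mapsto i\}\cup\{g\mapsto\bot\mid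 g\in\mathcal G\}))$. - $\mathsf{lock}(a)$: no change. - $\mathsf{unlock}(b)$: $P$ becomes $\{g\in P\mid (S\setminus\{b\})\cap\mathcal M[g]\neq\emptyset\}$. Side-effects: if $b=m_g$ then $[g]'\mapsto\sigma\,g$, and also $[g]\mapsto\sigma\,g$ if $\mathcal M[g]=\{m_g\}$; if $b$ is not a dedicated mutex, $[g]\mapsto\sigma\,g$ for all $g$ with $b\in\mathcal M[g]$. - $g=x$: $(P\cup\{g\},\sigma\oplus\{g\mapsto\sigma\,x\})$. - $x=g$: $x$ receives $\sigma\,g$ if $g\in P$; otherwise $\sigma\,g\sqcup\eta[g]'$ if $S\cap\mathcal M[g]=\{m_g\}$; otherwise $\sigma\,g\sqcup\eta[g]$. **$\mathcal C_1'$.** As $\mathcal C_1$, with these additional side-effects of $\mathsf{unlock}(b)$: $[g]\mapsto\sigma\,g$ for all $g$ with $\mathcal M[g]\setminus\{m_g\}\not\subseteq S\setminus\{b\}$; and $[g]'\mapsto\sigma\,g$ for all $g$ if $b$ is a dedicated mutex, respectively for all $g$ with $b\notin\mathcal M[g]$ if it is not. **$\mathcal C_3$ (Write-Centered Reading).** Unknowns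 $[u,S]$ with values $(W,P,\sigma)$, where $W,P$ map globals to upward-closed subsets of $2^{\mathsf M}$ (ordered by inclusion, denoted by generators), and $[g,a,S,w]$ ($g\in\mathcal G$, $a\in\mathsf M$, $S,w\subseteq\mathsf M$) with values in $\mathcal D$. Initially $[u_0,\emptyset]\sqsupseteq(g\mapsto\emptyset,\ g\mapsto\{\emptyset\},\ \sigma_0)$. Let $(W,P,\sigma)=\eta[u,S]$. - $x=\mathsf{create}(u_1)$: with $i=\nu_3\,u\,(W,P,\sigma)\,u_1$, set $x$ to $i$; side-effect $[u_1,\emptyset]\mapsto(g\mapsto\emptyset,\ g\mapsto\{\emptyset\},\ \sigma\oplus(\{\mathsf{self}\mapsto i\}\cup\{g\mapsto\bot\mid g\in\mathcal G\}))$. - $\mathsf{lock}(a)$: no change. - $\mathsf{unlock}(a)$: $P\,g$ becomes $P\,g\sqcup\{S\setminus\{a\}\}$ for every $g$; side-effects $[g,a,S\setminus\{a\},w]\mapsto\sigma\,g$ for all $g$ and all minimal $w\in W\,g$. - $g=x$: $W\,g$ and $P\,g$ become $\{S\}$, $\sigma\,g$ becomes $\sigma\,x$. - $x=g$: $x$ receives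 $\sigma\,g\sqcup\bigsqcup\{\eta[g,a,S',w]\mid a\in S,\ S\cap S'=\emptyset,\ \exists S''\in P\,g: S''\cap w=\emptyset,\ \exists S'''\in P\,g: a\notin S'''\}$. **Relating them.** Let $\gamma(P,\sigma)=(W',P',\sigma)$ with $W'\,g=\{\mathcal M[g]\}$ and $P'\,g=\{\{a\}\mid a\in\mathcal M[g]\}$ if $g\in P$, $P'\,g=\{\emptyset\}$ otherwise. The two analyses use the same abstract thread ids, at least in that $\nu_3\,u\,(\gamma\,q)\,u_1\sqsubseteq\nu_1\,u\,q\,u_1$ for all $u,q,u_1$. For $\mathcal M[g]\subseteq w$ define the description relation by: $[g,a,S,w]\,\mathcal R\,[g]$ if $a\in\mathcal M[g]\setminus\{m_g\}$; $[g,a,S,w]\,\mathcal R\,[g]$ if $a\in\{m_g\}\cup(\mathsf M\setminus\mathcal M[g])$ and $\mathcal M[g]\setminus\{m_g\}\not\subseteq S$; $[g,a,S,w]\,\mathcal R\,[g]'$ if $a\in\{m_g\}\cup(\mathsf M\setminus\mathcal M[g])$ and $\mathcal M[g]\setminus\{m_g\}\subseteq S$. From $\eta$ over the unknowns of $\mathcal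 C_1'$ define $\eta_3[u,S]=\gamma(\eta[u,S])$, and $\eta_3[g,a,S,w]$ to be $\eta[g]'$ if $a\in\{m_g\}\cup(\mathsf M\setminus\mathcal M[g])$, $\mathcal M[g]\setminus\{m_g\}\subseteq S$ and $\mathcal M[g]\subseteq w$; $\bot$ if $\mathcal M[g]\not\subseteq w$; and $\eta[g]$ otherwise. **Local traces.** A raw trace of a thread $i$ is a finite sequence of steps along control-flow edges through configurations $(j,u_j,\sigma_j)$ with $\sigma_j\,\mathsf{self}=i$, where locks succeed and reads may yield any value. A global trace consists of one raw trace for each of finitely many thread ids, a create order $\to_c$ and a locking order $\to_a$ for each mutex $a$, such that: the reflexive-transitive closure $\le$ of program, create and locking orders is a partial order whose least element is the start $(0,u_0,\sigma)$ of the initial thread; each other thread is created, with the creator's locals and a new $\mathsf{self}$, at exactly one node from which a creating edge is (or can be) taken, each node creates at most one thread, and the new id, also stored in the variable assigned by the creating edge, is $\nu(t)$ for the creator's local trace $t$; $\to_a$ relates each $\mathsf{lock}(a)$ node to exactly one predecessor, an $\mathsf{unlock}(a)$ node or the least element, and each node has at most one successor; a thread locks only mutexes it does not hold and unlocks only mutexes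 it holds; every read of $g$ yields the value of the last write to $g$ preceding it in $\le$. A local trace is a global trace with a unique maximal node; $L_t[\bar u]$ is the set of mutexes held by the thread of node $\bar u$ at $\bar u$. **Theorem.** There is an $\eta_1'$ which is the least solution of $\mathcal C_1'$ and also the least solution of $\mathcal C_1$, and 1. $\eta_1'[g]\sqsubseteq\eta_1'[g]'$ for all $g\in\mathcal G$; 2. the mapping $\eta_3$ built from $\eta_1'$ is a post-solution of $\mathcal C_3$; 3. whenever $[g,a,S,w]\,\mathcal R\,[g]'$, then $\eta_3[g,a,S,w]\sqsubseteq\eta_1'[g]'$; 4. whenever $[g,a,S,w]\,\mathcal R\,[g]$, then $\eta_3[g,a,S,w]\sqsubseteq\eta_1'[g]$; 5. (soundness) suppose values are concretized by a monotone $\gamma_{\mathcal D}:\mathcal D\to 2^{\mathcal V}$ with $\gamma_{\mathcal D}(\top)=\mathcal V$, the abstract effects of guards and local computations are sound, and $\nu(t)\in\gamma_{\mathcal D}(\nu_1\,u\,q\,u_1)$ for every local trace $t$ that ends at the source $u$ of an edge $(u,x=\mathsf{create}(u_1),v)$ and that is described by $q$. Here a local trace $t$ ending in $(u,\sigma)$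 with lockset $S$ is described by $q=(P^\sharp,\sigma^\sharp)$, written $\gamma(q)=(W^\sharp,\hat P^\sharp,\sigma^\sharp)$, if $\sigma\,x\in\gamma_{\mathcal D}(\sigma^\sharp\,x)$ for all locals $x$; for each $g$ written by the ego thread, the value it wrote last is in $\gamma_{\mathcal D}(\sigma^\sharp\,g)$, the lockset at that write is in $W^\sharp g$, and all locksets it has held since then are in $\hat P^\sharp g$; and $\emptyset\in\hat P^\sharp g$ for every $g$ that it has not written. Then every local trace ending at $u$ with lockset $S$ is described by $\eta_1'[u,S]$; and whenever a local trace $t$ ends in $\mathsf{unlock}(a)$ with lockset $S$, its ego thread has last written $g$ with value $d$ at lockset $w_0$, and $w\supseteq w_0$, then $[g,a,S,w]\,\mathcal R\,[g]$ implies $d\in\gamma_{\mathcal D}(\eta_1'[g])$ and $[g,a,S,w]\,\mathcal R\,[g]'$ implies $d\in\gamma_{\mathcal D}(\eta_1'[g]')$. -/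

import Mathlib

universe u

namespace ConcurrentAnalysis

open scoped Classical in
/-- `override f y d` is the map `f ⊕ {y ↦ d}`. -/
noncomputable def override {A B : Type u} (f : A → B) (y : A) (d : B) : A → B :=
  fun z => if z = y then d else f z

/-! ### Side-effecting systems of constraints -/

/-- A constraint `lhs ⊒ rhs` over unknowns `U`, the unknown `x` taking values in `Val x`.
Given an assignment, the right-hand side returns a collection of side-effects `x ↦ d`
together with the contribution to the left-hand side. -/
structure Constraint (U : Type u) (Val : U → Type u) where
  lhs : U
  rhs : ((x : U) → Val x) → Set ((x : U) × Val x) × Val lhs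

/-- `η` is a solution (also called post-solution) of `C`: all side-effects and all contributions
are accounted for by `η`. -/
def IsSolution {U : Type u} {Val : U → Type u} [∀ x, PartialOrder (Val x)]
    (C : Set (Constraint U Val)) (η : (x : U) → Val x) : Prop :=
  ∀ c ∈ C, (∀ e ∈ (c.rhs η).1, e.2 ≤ η e.1) ∧ (c.rhs η).2 ≤ η c.lhs

/-- `η` is the least solution of `C`. -/
def IsLeastSolution {U : Type u} {Val : U → Type u} [∀ x, PartialOrder (Val x)]
    (C : Set (Constraint U Val)) (η : (x : U) → Val x) : Prop :=
  IsLeast {ζ : (x : U) → Val x | IsSolution C ζ} η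

/-! ### Programs

`N` program points, `X` local variables, `G` global variables, `M` mutexes,
`L` guards and assignments on local variables. -/

inductive Action (N X G M L : Type u) : Type u
  | comp (l : L)
  | create (x : X) (u₁ : N)
  | lock (a : M)
  | unlock (a : M)
  | write (g : G) (x : X)
  | read (x : X) (g : G)

namespace Action

variable {N X G M L : Type u}

/-- The action reads from or writes to the global `g`. -/
def Accesses (A : Action N X G M L) (g : G) : Prop :=
  (∃ x, A = write g x) ∨ (∃ x, A = read x g)

/-- Mutexes are not re-entrant, and only a mutex that is held may be unlocked. -/
def Enabled (A : Action N X G M L) (S : Set M) : Prop :=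
  match A with
  | lock a => a ∉ S
  | unlock a => a ∈ S
  | _ => True

/-- The lockset after the action when `S` is the lockset before it. -/
def post (A : Action N X G M L) (S : Set M) : Set M :=
  match A with
  | lock a => S ∪ {a}
  | unlock a => S \ {a}
  | _ => S

end Action

structure Program (N X G M L : Type u) where
  /-- control-flow edges -/
  edges : Set (N × Action N X G M L × N)
  /-- start point of the initial thread -/
  start : N
  /-- the local variable holding the id of the current thread -/
  self : X
  /-- the dedicated mutex of a global -/
  mtx : G → M

namespace Program

variable {N X G M L : Type u} (p : Program N X G M L)

/-- Accesses to globals are atomic: every global `g` has a mutex `mtx g` of its own, every access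
`A` to `g` occurs in the form `lock (mtx g); A; unlock (mtx g)`, and `mtx g` is acquired only
immediately before an access to `g`. -/
structure Atomic : Prop where
  inj : Function.Injective p.mtx
  before : ∀ u A v g, (u, A, v) ∈ p.edges → A.Accesses g →
    ∀ u' B, (u', B, u) ∈ p.edges → B = Action.lock (p.mtx g)
  after : ∀ u A v g, (u, A, v) ∈ p.edges → A.Accesses g →
    ∀ B v', (v, B, v') ∈ p.edges → B = Action.unlock (p.mtx g)
  not_start : ∀ u A v g, (u, A, v) ∈ p.edges → A.Accesses g →
    u ≠ p.start ∧ ∀ u' x v', (u', Action.create x u, v') ∉ p.edges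
  dedicated : ∀ u v g, (u, Action.lock (p.mtx g), v) ∈ p.edges →
    ∀ B v', (v, B, v') ∈ p.edges → B.Accesses g

/-- `S` is an appropriate lockset for the program point `u`: along control-flow edges, a thread
can arrive at `u` with lockset `S`. -/
inductive Reach : N → Set M → Prop
  | start : Reach p.start ∅
  | step {u : N} {S : Set M} {A : Action N X G M L} {v : N} :
      Reach u S → (u, A, v) ∈ p.edges → A.Enabled S → Reach v (A.post S)
  | spawn {u : N} {S : Set M} {x : X} {u₁ v : N} :
      Reach u S → (u, Action.create x u₁, v) ∈ p.edges → Reach u₁ ∅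

/-- `prot g` is a set of mutexes, containing `mtx g`, all of which are held at each write
to `g`. -/
def WriteProtects (prot : G → Set M) : Prop :=
  (∀ g, p.mtx g ∈ prot g) ∧
  ∀ u S g x v, p.Reach u S → (u, Action.write g x, v) ∈ p.edges → prot g ⊆ S

end Program

/-- Abstract values of the local variables and of the local copies of the globals. -/
abbrev Store (X G D : Type u) : Type u := X ⊕ G → D

/-- The abstract store with the value `⊤` for all locals and `⊥` for all globals. -/
def initStore (X G : Type u) {D : Type u} [CompleteLattice D] : Store X G D :=
  Sum.elim (fun _ => ⊤) (fun _ => ⊥)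

/-- The store of a created thread: `σ ⊕ ({self ↦ i} ∪ {g ↦ ⊥ | g})`. -/
noncomputable def childStore {X G D : Type u} [CompleteLattice D] (self : X)
    (σ : Store X G D) (i : D) : Store X G D :=
  Sum.elim (override (fun x => σ (Sum.inl x)) self i) (fun _ => ⊥)

/-- A guard or local computation changes the abstract values of locals only. -/
def compStore {X G D : Type u} (f : (X → D) → (X → D)) (σ : Store X G D) : Store X G D :=
  Sum.elim (f (fun x => σ (Sum.inl x))) (fun g => σ (Sum.inr g))

/-! ### Protection-Based Reading -/

/-- Unknowns `[u,S]`, `[g]` and `[g]'`. -/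
inductive PUnk (N G M : Type u) : Type u
  | pt (u : N) (S : Set M)
  | glob (g : G)
  | glob' (g : G)

/-- Pairs `(P, σ)`; the sets `P` are ordered by `⊇`. -/
abbrev PState (X G D : Type u) : Type u := (Set G)ᵒᵈ × Store X G D

@[reducible] def PVal (N X G M D : Type u) : PUnk N G M → Type u
  | .pt _ _ => PState X G D
  | .glob _ => D
  | .glob' _ => D

instance {N X G M D : Type u} [CompleteLattice D] :
    (y : PUnk N G M) → PartialOrder (PVal N X G M D y)
  | .pt _ _ => inferInstanceAs (PartialOrder (PState X G D))
  | .glob _ => inferInstanceAs (PartialOrder D)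
  | .glob' _ => inferInstanceAs (PartialOrder D)

abbrev PAssign (N X G M D : Type u) : Type u := (y : PUnk N G M) → PVal N X G M D y

section ProtectionBased

variable {N X G M L D : Type u} [CompleteLattice D]
  (p : Program N X G M L) (prot : G → Set M)
  (comp : L → (X → D) → (X → D)) (nu : N → PState X G D → N → D)

/-- Side-effects of `unlock b` at lockset `S` in the original system. -/
def unlockEff (_S : Set M) (b : M) (σ : Store X G D) : Set ((y : PUnk N G M) × PVal N X G M D y) :=
  {e | ∃ g, b = p.mtx g ∧ e = ⟨.glob' g, σ (Sum.inr g)⟩} ∪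
  {e | ∃ g, b = p.mtx g ∧ prot g = {p.mtx g} ∧ e = ⟨.glob g, σ (Sum.inr g)⟩} ∪
  {e | b ∉ Set.range p.mtx ∧ ∃ g, b ∈ prot g ∧ e = ⟨.glob g, σ (Sum.inr g)⟩}

/-- Side-effects of `unlock b` at lockset `S` in the modified system: `[g]` additionally receives
the values of all globals which are not totally protected any more, and `[g]'` those of all
globals not protected by `b` (all globals, if `b` is a dedicated mutex). -/
def unlockEff' (S : Set M) (b : M) (σ : Store X G D) : Set ((y : PUnk N G M) × PVal N X G M D y) :=
  {e | ∃ g, ¬ (prot g \ {p.mtx g} ⊆ S \ {b}) ∧ e = ⟨.glob g, σ (Sum.inr g)⟩} ∪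
  {e | ∃ g, b = p.mtx g ∧ prot g = {p.mtx g} ∧ e = ⟨.glob g, σ (Sum.inr g)⟩} ∪
  {e | b ∈ Set.range p.mtx ∧ ∃ g, e = ⟨.glob' g, σ (Sum.inr g)⟩} ∪
  {e | b ∉ Set.range p.mtx ∧ ∃ g, b ∉ prot g ∧ e = ⟨.glob' g, σ (Sum.inr g)⟩}

open scoped Classical in
/-- Right-hand side for action `A` at the unknown `[u,S]`, where `eff` gives the side-effects
of unlocking. -/
noncomputable def pRhs
    (eff : Set M → M → Store X G D → Set ((y : PUnk N G M) × PVal N X G M D y))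
    (u : N) (S : Set M) (A : Action N X G M L) (η : PAssign N X G M D) :
    Set ((y : PUnk N G M) × PVal N X G M D y) × PState X G D :=
  let P : Set G := OrderDual.ofDual (η (.pt u S)).1
  let σ : Store X G D := (η (.pt u S)).2
  match A with
  | .comp l => (∅, (OrderDual.toDual P, compStore (comp l) σ))
  | .create x u₁ =>
      let i := nu u (OrderDual.toDual P, σ) u₁
      ({⟨.pt u₁ ∅, (OrderDual.toDual ∅, childStore p.self σ i)⟩},
        (OrderDual.toDual P, override σ (Sum.inl x) i))
  | .lock _ => (∅, (OrderDual.toDual P, σ))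
  | .unlock b =>
      (eff S b σ, (OrderDual.toDual {g ∈ P | ((S \ {b}) ∩ prot g).Nonempty}, σ))
  | .write g x =>
      (∅, (OrderDual.toDual (P ∪ {g}), override σ (Sum.inr g) (σ (Sum.inl x))))
  | .read x g =>
      let d : D :=
        if g ∈ P then σ (Sum.inr g)
        else if S ∩ prot g = {p.mtx g} then σ (Sum.inr g) ⊔ η (.glob' g)
        else σ (Sum.inr g) ⊔ η (.glob g)
      (∅, (OrderDual.toDual P, override σ (Sum.inl x) d))

/-- The system with side-effects `eff` of unlocking. -/
def pSystem (eff : Set M → M → Store X G D → Set ((y : PUnk N G M) × PVal N X G M D y)) :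
    Set (Constraint (PUnk N G M) (PVal N X G M D)) :=
  {⟨.pt p.start ∅, fun _ => (∅, (OrderDual.toDual ∅, initStore X G))⟩} ∪
  {c | ∃ u S A v, p.Reach u S ∧ (u, A, v) ∈ p.edges ∧ A.Enabled S ∧
    c = ⟨.pt v (A.post S), pRhs p prot comp nu eff u S A⟩}

/-- The constraint system of Protection-Based Reading. -/
def C₁ : Set (Constraint (PUnk N G M) (PVal N X G M D)) :=
  pSystem p prot comp nu (unlockEff p prot)

/-- The modified constraint system of Protection-Based Reading. -/
def C₁' : Set (Constraint (PUnk N G M) (PVal N X G M D)) :=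
  pSystem p prot comp nu (unlockEff' p prot)

end ProtectionBased

/-! ### Write-Centered Reading -/

/-- Upward-closed sets of locksets, ordered by inclusion (`UpperSet` carries the reverse order). -/
abbrev UpLocks (M : Type u) : Type u := (UpperSet (Set M))ᵒᵈ

/-- The upward-closed set of locksets generated by `B`. -/
def upLocks {M : Type u} (B : Set (Set M)) : UpLocks M := OrderDual.toDual (upperClosure B)

/-- `S` belongs to the upward-closed set `A`. -/
def UpMem {M : Type u} (S : Set M) (A : UpLocks M) : Prop := S ∈ OrderDual.ofDual A

/-- Unknowns `[u,S]` and `[g,a,S,w]`. -/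
inductive WUnk (N G M : Type u) : Type u
  | pt (u : N) (S : Set M)
  | glob (g : G) (a : M) (S w : Set M)

/-- Triples `(W, P, σ)`. -/
abbrev WState (X G M D : Type u) : Type u := (G → UpLocks M) × (G → UpLocks M) × Store X G D

@[reducible] def WVal (N X G M D : Type u) : WUnk N G M → Type u
  | .pt _ _ => WState X G M D
  | .glob _ _ _ _ => D

instance {N X G M D : Type u} [CompleteLattice D] :
    (y : WUnk N G M) → PartialOrder (WVal N X G M D y)
  | .pt _ _ => inferInstanceAs (PartialOrder (WState X G M D))
  | .glob _ _ _ _ => inferInstanceAs (PartialOrder D)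

abbrev WAssign (N X G M D : Type u) : Type u := (y : WUnk N G M) → WVal N X G M D y

section WriteCentered

variable {N X G M L D : Type u} [CompleteLattice D]
  (p : Program N X G M L)
  (comp : L → (X → D) → (X → D)) (nu : N → WState X G M D → N → D)

/-- Right-hand side for action `A` at the unknown `[u,S]`. When unlocking, `w` ranges over the
minimal elements of `W g`. -/
noncomputable def wRhs (u : N) (S : Set M) (A : Action N X G M L) (η : WAssign N X G M D) :
    Set ((y : WUnk N G M) × WVal N X G M D y) × WState X G M D :=
  let W : G → UpLocks M := (η (.pt u S)).1
  let P : G → UpLocks M := (η (.pt u S)).2.1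
  let σ : Store X G D := (η (.pt u S)).2.2
  match A with
  | .comp l => (∅, (W, P, compStore (comp l) σ))
  | .create x u₁ =>
      let i := nu u (W, P, σ) u₁
      ({⟨.pt u₁ ∅, (fun _ => upLocks ∅, fun _ => upLocks {∅}, childStore p.self σ i)⟩},
        (W, P, override σ (Sum.inl x) i))
  | .lock _ => (∅, (W, P, σ))
  | .unlock a =>
      ({e | ∃ g w, Minimal (fun w' => UpMem w' (W g)) w ∧
          e = ⟨.glob g a (S \ {a}) w, σ (Sum.inr g)⟩},
        (W, fun g => P g ⊔ upLocks {S \ {a}}, σ))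
  | .write g x =>
      (∅, (override W g (upLocks {S}), override P g (upLocks {S}),
        override σ (Sum.inr g) (σ (Sum.inl x))))
  | .read x g =>
      let d : D := σ (Sum.inr g) ⊔
        sSup {d | ∃ a S' w, a ∈ S ∧ S ∩ S' = ∅ ∧
          (∃ S'', UpMem S'' (P g) ∧ S'' ∩ w = ∅) ∧
          (∃ S''', UpMem S''' (P g) ∧ a ∉ S''') ∧
          d = η (.glob g a S' w)}
      (∅, (W, P, override σ (Sum.inl x) d))

/-- The constraint system of Write-Centered Reading. -/
def C₃ : Set (Constraint (WUnk N G M) (WVal N X G M D)) :=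
  {⟨.pt p.start ∅, fun _ => (∅, (fun _ => upLocks ∅, fun _ => upLocks {∅}, initStore X G))⟩} ∪
  {c | ∃ u S A v, p.Reach u S ∧ (u, A, v) ∈ p.edges ∧ A.Enabled S ∧
    c = ⟨.pt v (A.post S), wRhs p comp nu u S A⟩}

end WriteCentered

/-! ### From Protection-Based to Write-Centered Reading -/

section Relating

variable {N X G M L D : Type u} (p : Program N X G M L) (prot : G → Set M)

open scoped Classical in
/-- The mapping `γ` from states `(P, σ)` to states `(W, P, σ)`. -/
noncomputable def gammaState (s : PState X G D) : WState X G M D :=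
  (fun g => upLocks {prot g},
   fun g => if g ∈ OrderDual.ofDual s.1 then upLocks {B | ∃ a ∈ prot g, B = {a}} else upLocks {∅},
   s.2)

open scoped Classical in
/-- The mapping `η₃` built from an assignment of the Protection-Based system. -/
noncomputable def eta₃ [CompleteLattice D] (η : PAssign N X G M D) : WAssign N X G M D
  | .pt u S => gammaState prot (η (.pt u S))
  | .glob g a S w =>
      if (a = p.mtx g ∨ a ∉ prot g) ∧ prot g \ {p.mtx g} ⊆ S ∧ prot g ⊆ w then η (.glob' g)
      else if ¬ prot g ⊆ w then (⊥ : D)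
      else η (.glob g)

/-- The description relation between the unknowns of the two systems. -/
inductive Describes : WUnk N G M → PUnk N G M → Prop
  | pt (u : N) (S : Set M) : Describes (.pt u S) (.pt u S)
  | own (g : G) (a : M) (S w : Set M) : prot g ⊆ w → a ∈ prot g \ {p.mtx g} →
      Describes (.glob g a S w) (.glob g)
  | released (g : G) (a : M) (S w : Set M) : prot g ⊆ w → (a = p.mtx g ∨ a ∉ prot g) →
      ¬ (prot g \ {p.mtx g} ⊆ S) → Describes (.glob g a S w) (.glob g)
  | retained (g : G) (a : M) (S w : Set M) : prot g ⊆ w → (a = p.mtx g ∨ a ∉ prot g) →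
      prot g \ {p.mtx g} ⊆ S → Describes (.glob g a S w) (.glob' g)

end Relating

/-! ### The local trace semantics -/

/-- A node `(j, u, σ)`: the `j`-th configuration of the thread `σ self`. -/
structure Node (N X V : Type u) : Type u where
  idx : ℕ
  pt : N
  st : X → V

/-- A graph of thread steps together with a create order and, for each mutex, a locking order. -/
structure Trace (N X G M L V : Type u) : Type u where
  nodes : Set (Node N X V)
  edges : Set (Node N X V × Action N X G M L × Node N X V)
  created : Node N X V → Node N X V → Prop
  locked : M → Node N X V → Node N X V → Prop

/-- The concrete meaning of a program: (possibly partial or non-deterministic) execution of guards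
and local assignments, the id of the initial thread, and the id of the thread which is created
next when the creating thread has the given local trace. -/
structure Semantics (N X G M L V : Type u) : Type u where
  exec : L → (X → V) → Set (X → V)
  initId : V
  newId : Trace N X G M L V → V

/-- Effect of an action on the locals of the executing thread, when considered in isolation. -/
def LocalStep {N X G M L V : Type u} (sem : Semantics N X G M L V) (ρ : X → V)
    (A : Action N X G M L) (ρ' : X → V) : Prop :=
  match A with
  | .comp l => ρ' ∈ sem.exec l ρ
  | .create x _ => ∃ i, ρ' = override ρ x i
  | .read x _ => ∃ d, ρ' = override ρ x d
  | _ => ρ' = ρ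

/-- A finite sequence of `len` steps; entries beyond `len` are irrelevant. -/
structure RawTrace (N X G M L V : Type u) : Type u where
  len : ℕ
  conf : ℕ → N × (X → V)
  act : ℕ → Action N X G M L

namespace RawTrace

variable {N X G M L V : Type u} (r : RawTrace N X G M L V)

def node (j : ℕ) : Node N X V := ⟨j, (r.conf j).1, (r.conf j).2⟩

def nodes : Set (Node N X V) := {n | ∃ j, j ≤ r.len ∧ n = r.node j}

def edges : Set (Node N X V × Action N X G M L × Node N X V) :=
  {e | ∃ j, j < r.len ∧ e = (r.node j, r.act j, r.node (j + 1))}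

/-- `r` is a raw trace of the thread `i`. -/
def IsRaw (p : Program N X G M L) (sem : Semantics N X G M L V) (i : V) : Prop :=
  (∀ j ≤ r.len, (r.conf j).2 p.self = i) ∧
  ∀ j < r.len, ((r.conf j).1, r.act j, (r.conf (j + 1)).1) ∈ p.edges ∧
    LocalStep sem (r.conf j).2 (r.act j) (r.conf (j + 1)).2

end RawTrace

namespace Trace

variable {N X G M L V : Type u} (p : Program N X G M L) (sem : Semantics N X G M L V)
  (t : Trace N X G M L V)

/-- Causality order. -/
def le : Node N X V → Node N X V → Prop :=
  Relation.ReflTransGen fun m n =>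
    (∃ A, (m, A, n) ∈ t.edges) ∨ t.created m n ∨ ∃ a, t.locked a m n

/-- The sub-trace of all nodes below `n`. -/
def down (n : Node N X V) : Trace N X G M L V where
  nodes := {m | m ∈ t.nodes ∧ t.le m n}
  edges := {e | e ∈ t.edges ∧ t.le e.1 n ∧ t.le e.2.2 n}
  created := fun m m' => t.created m m' ∧ t.le m n ∧ t.le m' n
  locked := fun a m m' => t.locked a m m' ∧ t.le m n ∧ t.le m' n

/-- The mutexes acquired by the thread of `n`, up to `n`, and not yet released. -/
def lockset (n : Node N X V) : Set M :=
  {a | ∃ m m', (m, Action.lock a, m') ∈ t.edges ∧ m'.st p.self = n.st p.self ∧ m'.idx ≤ n.idx ∧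
    ∀ k k', (k, Action.unlock a, k') ∈ t.edges → k'.st p.self = n.st p.self →
      m'.idx < k'.idx → ¬ k'.idx ≤ n.idx}

/-- `t` is a global trace of the program. Here, `z` is the initial node. -/
structure IsGlobal (z : Node N X V) : Prop where
  /-- finitely many threads, each with one raw trace -/
  raw : ∃ (I : Set V) (r : V → RawTrace N X G M L V), I.Finite ∧ (∀ i ∈ I, (r i).IsRaw p sem i) ∧
    t.nodes = (⋃ i ∈ I, (r i).nodes) ∧ t.edges = ⋃ i ∈ I, (r i).edges
  /-- mutexes are not re-entrant, and only released when held -/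
  enabled : ∀ m A n, (m, A, n) ∈ t.edges → A.Enabled (t.lockset p m)
  /-- causality order -/
  init : z ∈ t.nodes ∧ z.idx = 0 ∧ z.pt = p.start ∧ z.st p.self = sem.initId
  least : ∀ n ∈ t.nodes, t.le z n
  antisymm : ∀ m n, t.le m n → t.le n m → m = n
  /-- create order: a thread is created at a node where a creating edge is (or may be) taken -/
  created_dom : ∀ m s, t.created m s → m ∈ t.nodes ∧ s ∈ t.nodes ∧ s.idx = 0 ∧ s ≠ z ∧
    (∃ x v, (m.pt, Action.create x s.pt, v) ∈ p.edges) ∧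
    (∀ A n, (m, A, n) ∈ t.edges → ∃ x, A = Action.create x s.pt) ∧
    s.st = override m.st p.self (sem.newId (t.down m))
  created_unique : ∀ s ∈ t.nodes, s.idx = 0 → s ≠ z → ∃! m, t.created m s
  created_inj : ∀ m s s', t.created m s → t.created m s' → s = s'
  create_val : ∀ m x v n, (m, Action.create x v, n) ∈ t.edges →
    n.st = override m.st x (sem.newId (t.down m))
  /-- locking order -/
  locked_dom : ∀ a m n, t.locked a m n →
    (m = z ∨ ∃ k, (k, Action.unlock a, m) ∈ t.edges) ∧ ∃ k, (k, Action.lock a, n) ∈ t.edges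
  locked_unique : ∀ a k n, (k, Action.lock a, n) ∈ t.edges → ∃! m, t.locked a m n
  locked_inj : ∀ a m n n', t.locked a m n → t.locked a m n' → n = n'
  /-- a read yields the value of the last preceding write -/
  read_val : ∀ m x g n, (m, Action.read x g, n) ∈ t.edges →
    ∃ k y k', (k, Action.write g y, k') ∈ t.edges ∧ t.le k' m ∧
      (∀ l y' l', (l, Action.write g y', l') ∈ t.edges → t.le l' m → t.le k' l' → l' = k') ∧
      n.st x = k.st y

/-- `s` is the maximal node of `t`. -/
def IsSink (s : Node N X V) : Prop := s ∈ t.nodes ∧ ∀ n ∈ t.nodes, t.le n s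

/-- The action `A` is the last one executed by the ego thread, where `s` is the sink. -/
def IsLast (s : Node N X V) (A : Action N X G M L) : Prop := ∃ m, (m, A, s) ∈ t.edges

/-- `(m, g = x, n)` is the last thread-local write to `g` in `t`, where `s` is the sink. -/
def IsLastWrite (s : Node N X V) (g : G) (m : Node N X V) (x : X) (n : Node N X V) : Prop :=
  (m, Action.write g x, n) ∈ t.edges ∧ n.st p.self = s.st p.self ∧
  ∀ k y k', (k, Action.write g y, k') ∈ t.edges → k'.st p.self = s.st p.self → k'.idx ≤ n.idx

end Trace

section Soundness

variable {N X G M L V D : Type u} (p : Program N X G M L) (sem : Semantics N X G M L V)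

/-- The set of all local traces of the program. -/
def Traces : Set (Trace N X G M L V) := {t | (∃ z, t.IsGlobal p sem z) ∧ ∃ s, t.IsSink s}

/-- Local traces reaching `u` with lockset `S`. -/
def tracesAt (u : N) (S : Set M) : Set (Trace N X G M L V) :=
  {t | t ∈ Traces p sem ∧ ∃ s, t.IsSink s ∧ s.pt = u ∧ t.lockset p s = S}

/-- Local traces ending in `unlock a` with background lockset `S`, where the lockset at the last
thread-local write to `g` (if there is any) is contained in `w`. -/
def tracesGlob (g : G) (a : M) (S w : Set M) : Set (Trace N X G M L V) :=
  {t | t ∈ Traces p sem ∧ ∃ s, t.IsSink s ∧ t.IsLast s (Action.unlock a) ∧ t.lockset p s = S ∧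
    ∀ m x n, t.IsLastWrite p s g m x n → t.lockset p n ⊆ w}

/-- For each global, the lockset at the last thread-local write. -/
def betaW (t : Trace N X G M L V) (s : Node N X V) (g : G) : UpLocks M :=
  upLocks {B | ∃ m x n, t.IsLastWrite p s g m x n ∧ B = t.lockset p n}

/-- For each global, the locksets held by the ego thread since its last write to it (`{∅}` if
there is no such write). -/
def betaP (t : Trace N X G M L V) (s : Node N X V) (g : G) : UpLocks M :=
  upLocks ({B | ∃ m x n, t.IsLastWrite p s g m x n ∧
      ∃ k ∈ t.nodes, k.st p.self = s.st p.self ∧ n.idx ≤ k.idx ∧ B = t.lockset p k} ∪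
    {B | (¬ ∃ m x n, t.IsLastWrite p s g m x n) ∧ B = ∅})

/-- The values of the locals at the sink, and the values last written to the globals by the ego
thread. -/
def betaStore (t : Trace N X G M L V) (s : Node N X V) : X ⊕ G → Set V
  | .inl x => {s.st x}
  | .inr g => {d | ∃ m x n, t.IsLastWrite p s g m x n ∧ d = m.st x}

/-- Concretization of a state of Write-Centered Reading at the unknown `[u,S]`. -/
def gammaAt (conc : D → Set V) (u : N) (S : Set M) (q : WState X G M D) :
    Set (Trace N X G M L V) :=
  {t | t ∈ Traces p sem ∧ ∃ s, t.IsSink s ∧ s.pt = u ∧ t.lockset p s = S ∧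
    betaW p t s ≤ q.1 ∧ betaP p t s ≤ q.2.1 ∧ ∀ y, betaStore p t s y ⊆ conc (q.2.2 y)}

/-- Concretization of a value at the unknown `[g,a,S,w]`. -/
def gammaGlob (conc : D → Set V) (g : G) (a : M) (S w : Set M) (d : D) :
    Set (Trace N X G M L V) :=
  {t | t ∈ Traces p sem ∧ ∃ s, t.IsSink s ∧ t.IsLast s (Action.unlock a) ∧ t.lockset p s = S ∧
    ∀ m x n, t.IsLastWrite p s g m x n → m.st x ∈ conc d ∧ t.lockset p n ⊆ w}

/-- The ingredients of the analysis are sound for the concrete semantics: the concretization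
`conc` of abstract values, the abstract effect `comp` of guards and local computations, and the
abstract thread ids `nu`. -/
structure SoundIngredients [CompleteLattice D] (prot : G → Set M) (conc : D → Set V)
    (comp : L → (X → D) → (X → D)) (nu : N → PState X G D → N → D) : Prop where
  conc_mono : Monotone conc
  conc_top : conc ⊤ = Set.univ
  comp_sound : ∀ l (σ : X → D) (ρ ρ' : X → V), (∀ x, ρ x ∈ conc (σ x)) → ρ' ∈ sem.exec l ρ →
    ∀ x, ρ' x ∈ conc (comp l σ x)
  nu_sound : ∀ u S q x u₁ v, (u, Action.create x u₁, v) ∈ p.edges →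
    ∀ t ∈ gammaAt p sem conc u S (gammaState prot q), sem.newId t ∈ conc (nu u q u₁)

/-- The result `η` of Protection-Based Reading is sound w.r.t. the local trace semantics: each
local trace is described by the values of the unknowns it contributes to. -/
def SoundFor [CompleteLattice D] (prot : G → Set M) (conc : D → Set V)
    (η : PAssign N X G M D) : Prop :=
  (∀ u S, tracesAt p sem u S ⊆ gammaAt p sem conc u S (gammaState prot (η (.pt u S)))) ∧
  (∀ g a S w, Describes p prot (.glob g a S w) (.glob g : PUnk N G M) →
    tracesGlob p sem g a S w ⊆ gammaGlob p sem conc g a S w (η (.glob g))) ∧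
  (∀ g a S w, Describes p prot (.glob g a S w) (.glob' g : PUnk N G M) →
    tracesGlob p sem g a S w ⊆ gammaGlob p sem conc g a S w (η (.glob' g)))

end Soundness

end ConcurrentAnalysis

/-!
The constraints of `C₁` are monotone, so `C₁` has a least solution `η`. Lowering `η` at the program
points, so that a local copy of `g` exceeds `η [g]'` only while `mtx g` is held, and exceeds
`η [g]` only while all other mutexes of `prot g` are held, does not violate any constraint, because
every `unlock` at which one of these bounds starts to apply publishes the copy. By leastness `η`
obeys the bounds already, so the additional side-effects of `C₁'` change nothing.

For `η₃` only reads need an argument. A read of `g` at lockset `S` sees `η₃ [g,a,S',w]` only if `S`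
and `S'` are disjoint and, unless this value is `⊥`, `g ∉ P`. If it is `η [g]'`, then `S'` contains
`prot g \ {mtx g}`, hence `S ∩ prot g = {mtx g}`, and Protection-Based Reading joins `η [g]'` too.
Otherwise it is `η [g]`, which is below `η [g]'`.

Soundness is an induction along causality order. If a thread reads a value of `g` written by
another thread, then each mutex of `prot g` it holds has been released by the writer in between,
and that `unlock` published the value. If `g ∈ P`, the reader has written `g` itself and has always
held a mutex of `prot g` since then. Another write seen by the read would come causally after the
reader's own, at a lockset containing `prot g`; but the lockset of the last node of the reader
causally before that write is disjoint from it, and hence from `prot g`.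
-/

namespace ConcurrentAnalysis

section Override

variable {A B : Type u}

@[simp] theorem override_same (f : A → B) (y : A) (d : B) : override f y d y = d := if_pos rfl

theorem override_of_ne {f : A → B} {y z : A} {d : B} (h : z ≠ y) : override f y d z = f z :=
  if_neg h

theorem override_le_iff [Preorder B] {f h : A → B} {y : A} {d : B} :
    override f y d ≤ h ↔ d ≤ h y ∧ ∀ z ≠ y, f z ≤ h z := by
  constructor
  · intro hle
    exact ⟨by simpa using hle y, fun z hz => by simpa [override_of_ne hz] using hle z⟩
  · rintro ⟨hd, hf⟩ z
    by_cases hz : z = y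
    · subst hz
      simpa using hd
    · simpa [override_of_ne hz] using hf z hz

theorem override_mono [Preorder B] {f f' : A → B} {y : A} {d d' : B} (hf : f ≤ f') (hd : d ≤ d') :
    override f y d ≤ override f' y d' :=
  override_le_iff.2 ⟨by simpa using hd, fun z hz => by simpa [override_of_ne hz] using hf z⟩

end Override

/-! ### Monotone systems of constraints -/

section Constraints

variable {U : Type u} {Val : U → Type u} [∀ x, PartialOrder (Val x)]
  {C : Set (Constraint U Val)} {η ζ : (x : U) → Val x}

/-- The assignment `η` accounts for all side-effects in `E`. -/
def Covers (η : (x : U) → Val x) (E : Set ((x : U) × Val x)) : Prop := ∀ e ∈ E, e.2 ≤ η e.1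

theorem covers_empty : Covers η ∅ := fun _ => False.elim

theorem covers_singleton {x : U} {d : Val x} : Covers η {⟨x, d⟩} ↔ d ≤ η x :=
  ⟨fun h => h ⟨x, d⟩ rfl, by rintro h _ rfl; exact h⟩

/-- The right-hand side of `c` depends monotonically on the assignment. Collections of
side-effects are compared by the assignments covering them. -/
def Constraint.Mono (c : Constraint U Val) : Prop :=
  ∀ ⦃η η' : (x : U) → Val x⦄, η ≤ η' →
    (∀ ζ, Covers ζ (c.rhs η').1 → Covers ζ (c.rhs η).1) ∧ (c.rhs η).2 ≤ (c.rhs η').2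

theorem exists_isLeastSolution (hC : ∀ c ∈ C, c.Mono)
    (hglb : ∀ x (s : Set (Val x)), ∃ b, IsGLB s b) : ∃ η, IsLeastSolution C η := by
  choose inf hinf using hglb
  let η : (x : U) → Val x := fun x => inf x {d | ∃ ζ, IsSolution C ζ ∧ d = ζ x}
  have hle : ∀ ζ, IsSolution C ζ → η ≤ ζ := fun ζ hζ x => (hinf x _).1 ⟨ζ, hζ, rfl⟩
  refine ⟨η, fun c hc => ⟨fun e he => (hinf _ _).2 ?_, (hinf _ _).2 ?_⟩, fun ζ hζ => hle ζ hζ⟩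
  · rintro _ ⟨ζ, hζ, rfl⟩
    exact (hC c hc (hle ζ hζ)).1 ζ (hζ c hc).1 e he
  · rintro _ ⟨ζ, hζ, rfl⟩
    exact (hC c hc (hle ζ hζ)).2.trans (hζ c hc).2

theorem IsLeastSolution.le_of_preserved (hC : ∀ c ∈ C, c.Mono) (hη : IsLeastSolution C η)
    (hle : ζ ≤ η) (hζ : ∀ c ∈ C, Covers η (c.rhs ζ).1 → (c.rhs ζ).2 ≤ η c.lhs →
      Covers ζ (c.rhs ζ).1 ∧ (c.rhs ζ).2 ≤ ζ c.lhs) : η ≤ ζ :=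
  hη.2 fun c hc =>
    have hmono := hC c hc hle
    hζ c hc (hmono.1 η (hη.1 c hc).1) (hmono.2.trans (hη.1 c hc).2)

end Constraints

/-! ### Appropriate locksets of atomic programs -/

theorem Action.eq_lock_of_mem_post {N X G M L : Type u} {A : Action N X G M L} {S : Set M} {a : M}
    (ha : a ∈ A.post S) (haS : a ∉ S) : A = lock a := by
  cases A <;> simp_all [post]

theorem Action.eq_unlock_of_notMem_post {N X G M L : Type u} {A : Action N X G M L} {S : Set M}
    {a : M} (ha : a ∉ A.post S) (haS : a ∈ S) : A = unlock a := by
  cases A <;> simp_all [post]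

namespace Program

variable {N X G M L : Type u} {p : Program N X G M L} {prot : G → Set M} {u v : N} {S : Set M}
  {g h : G} {b : M}

theorem Reach.mtx_mem_of_accesses (hp : p.Atomic) (hr : p.Reach u S) {A : Action N X G M L}
    (he : (u, A, v) ∈ p.edges) (hA : A.Accesses g) : p.mtx g ∈ S := by
  cases hr with
  | start => exact absurd rfl (hp.not_start _ _ _ _ he hA).1
  | step _ he' _ =>
    obtain rfl := hp.before _ _ _ _ he hA _ _ he'
    exact Or.inr rfl
  | spawn _ he' => exact absurd he' ((hp.not_start _ _ _ _ he hA).2 _ _ _)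

theorem Reach.exists_lock_or_access_of_mtx_mem (hp : p.Atomic) (hr : p.Reach u S)
    (hg : p.mtx g ∈ S) :
    (∃ u', (u', Action.lock (p.mtx g), u) ∈ p.edges) ∨
      ∃ u' A, A.Accesses g ∧ (u', A, u) ∈ p.edges := by
  induction hr with
  | start => exact absurd hg (Set.notMem_empty _)
  | spawn => exact absurd hg (Set.notMem_empty _)
  | @step u S A v _ he _ ih =>
    by_cases hS : p.mtx g ∈ S
    · rcases ih hS with ⟨u', hu'⟩ | ⟨u', B, hB, hu'⟩
      · exact Or.inr ⟨u, A, hp.dedicated _ _ _ hu' _ _ he, he⟩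
      · obtain rfl := hp.after _ _ _ _ hu' hB _ _ he
        exact absurd rfl hg.2
    · obtain rfl := Action.eq_lock_of_mem_post hg hS
      exact Or.inl ⟨u, he⟩

theorem Reach.eq_mtx_of_unlock (hp : p.Atomic) (hr : p.Reach u S)
    (he : (u, Action.unlock b, v) ∈ p.edges) (hg : p.mtx g ∈ S) : b = p.mtx g := by
  rcases hr.exists_lock_or_access_of_mtx_mem hp hg with ⟨u', hu'⟩ | ⟨u', B, hB, hu'⟩
  · rcases hp.dedicated _ _ _ hu' _ _ he with ⟨x, h⟩ | ⟨x, h⟩ <;> cases h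
  · exact Action.unlock.inj (hp.after _ _ _ _ hu' hB _ _ he)

theorem Reach.mtx_notMem_of_unlock (hp : p.Atomic) (hr : p.Reach u S)
    (he : (u, Action.unlock b, v) ∈ p.edges) (g : G) : p.mtx g ∉ S \ {b} :=
  fun h => h.2 (hr.eq_mtx_of_unlock hp he h.1).symm

theorem Reach.eq_of_write_of_mtx_mem (hp : p.Atomic) (hr : p.Reach u S) {x : X}
    (he : (u, Action.write g x, v) ∈ p.edges) (hh : p.mtx h ∈ S) : h = g := by
  have hA : (Action.write g x : Action N X G M L).Accesses g := Or.inl ⟨x, rfl⟩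
  rcases hr.exists_lock_or_access_of_mtx_mem hp hh with ⟨u', hu'⟩ | ⟨u', B, hB, hu'⟩
  · exact hp.inj (Action.lock.inj (hp.before _ _ _ _ he hA _ _ hu'))
  · obtain rfl := hp.before _ _ _ _ he hA _ _ hu'
    rcases hB with ⟨y, h⟩ | ⟨y, h⟩ <;> cases h

/-- Some reachable edge of the program writes to `g`. Only for such `g` does `WriteProtects`
restrict the set `prot g`. -/
def Written (p : Program N X G M L) (g : G) : Prop :=
  ∃ u S x v, p.Reach u S ∧ (u, Action.write g x, v) ∈ p.edges

theorem Written.notMem_range_mtx (hp : p.Atomic) (hprot : p.WriteProtects prot)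
    (hg : p.Written g) (hb : b ∈ prot g) (hne : b ≠ p.mtx g) : b ∉ Set.range p.mtx := by
  obtain ⟨u, S, x, v, hr, he⟩ := hg
  rintro ⟨h, rfl⟩
  exact hne (congrArg _ (hr.eq_of_write_of_mtx_mem hp he (hprot.2 _ _ _ _ _ hr he hb)))

end Program

/-! ### Monotonicity of Protection-Based Reading -/

section ProtectionBased

variable {N X G M L D : Type u} [CompleteLattice D] {p : Program N X G M L} {prot : G → Set M}
  {comp : L → (X → D) → (X → D)} {nu : N → PState X G D → N → D}
  {eff eff' : Set M → M → Store X G D → Set ((y : PUnk N G M) × PVal N X G M D y)}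
  {η ζ : PAssign N X G M D} {u : N} {S : Set M} {g : G}

theorem compStore_mono {f : (X → D) → (X → D)} (hf : Monotone f) {σ σ' : Store X G D}
    (h : σ ≤ σ') : compStore f σ ≤ compStore f σ' := by
  rintro (x | g)
  · exact hf (fun x => h (Sum.inl x)) x
  · exact h (Sum.inr g)

theorem childStore_mono {self : X} {σ σ' : Store X G D} {i i' : D} (h : σ ≤ σ') (hi : i ≤ i') :
    childStore self σ i ≤ childStore self σ' i' := by
  rintro (x | g)
  · exact override_mono (fun x => h (Sum.inl x)) hi x
  · exact le_rfl

theorem PVal.exists_isGLB : ∀ (y : PUnk N G M) (s : Set (PVal N X G M D y)), ∃ b, IsGLB s b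
  | .pt _ _, s => ⟨(sInf s : PState X G D), isGLB_sInf (α := PState X G D) s⟩
  | .glob _, s => ⟨(sInf s : D), isGLB_sInf (α := D) s⟩
  | .glob' _, s => ⟨(sInf s : D), isGLB_sInf (α := D) s⟩

theorem covers_unlockEff_iff {b : M} {σ : Store X G D} :
    Covers ζ (unlockEff p prot S b σ) ↔
      (∀ g, b = p.mtx g → σ (Sum.inr g) ≤ (ζ (.glob' g) : D)) ∧
      (∀ g, b = p.mtx g → prot g = {p.mtx g} → σ (Sum.inr g) ≤ (ζ (.glob g) : D)) ∧
      (∀ g, b ∉ Set.range p.mtx → b ∈ prot g → σ (Sum.inr g) ≤ (ζ (.glob g) : D)) := by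
  constructor
  · intro h
    exact ⟨fun g hb => h ⟨.glob' g, _⟩ (Or.inl (Or.inl ⟨g, hb, rfl⟩)),
      fun g hb hg => h ⟨.glob g, _⟩ (Or.inl (Or.inr ⟨g, hb, hg, rfl⟩)),
      fun g hb hg => h ⟨.glob g, _⟩ (Or.inr ⟨hb, g, hg, rfl⟩)⟩
  · rintro ⟨h1, h2, h3⟩ e ((⟨g, hb, rfl⟩ | ⟨g, hb, hg, rfl⟩) | ⟨hb, g, hg, rfl⟩)
    exacts [h1 g hb, h2 g hb hg, h3 g hb hg]

theorem covers_unlockEff'_iff {b : M} {σ : Store X G D} :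
    Covers ζ (unlockEff' p prot S b σ) ↔
      (∀ g, ¬ (prot g \ {p.mtx g} ⊆ S \ {b}) → σ (Sum.inr g) ≤ (ζ (.glob g) : D)) ∧
      (∀ g, b = p.mtx g → prot g = {p.mtx g} → σ (Sum.inr g) ≤ (ζ (.glob g) : D)) ∧
      (∀ g, b ∈ Set.range p.mtx ∨ b ∉ prot g → σ (Sum.inr g) ≤ (ζ (.glob' g) : D)) := by
  constructor
  · intro h
    refine ⟨fun g hg => h ⟨.glob g, _⟩ (Or.inl (Or.inl (Or.inl ⟨g, hg, rfl⟩))),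
      fun g hb hg => h ⟨.glob g, _⟩ (Or.inl (Or.inl (Or.inr ⟨g, hb, hg, rfl⟩))), fun g hg => ?_⟩
    by_cases hb : b ∈ Set.range p.mtx
    · exact h ⟨.glob' g, _⟩ (Or.inl (Or.inr ⟨hb, g, rfl⟩))
    · exact h ⟨.glob' g, _⟩ (Or.inr ⟨hb, g, hg.resolve_left hb, rfl⟩)
  · rintro ⟨h1, h2, h3⟩ e (((⟨g, hg, rfl⟩ | ⟨g, hb, hg, rfl⟩) | ⟨hb, g, rfl⟩) | ⟨_, g, hg, rfl⟩)
    exacts [h1 g hg, h2 g hb hg, h3 g (Or.inl hb), h3 g (Or.inr hg)]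

theorem Covers.unlockEff_mono {b : M} {σ σ' : Store X G D} (h : σ ≤ σ')
    (hζ : Covers ζ (unlockEff p prot S b σ')) : Covers ζ (unlockEff p prot S b σ) := by
  obtain ⟨h1, h2, h3⟩ := covers_unlockEff_iff.1 hζ
  exact covers_unlockEff_iff.2 ⟨fun g hb => (h _).trans (h1 g hb),
    fun g hb hg => (h _).trans (h2 g hb hg), fun g hb hg => (h _).trans (h3 g hb hg)⟩

open scoped Classical in
/-- The value obtained by reading `g` in the state `q` at lockset `S`. -/
noncomputable def pRead (p : Program N X G M L) (prot : G → Set M) (η : PAssign N X G M D)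
    (S : Set M) (q : PState X G D) (g : G) : D :=
  if g ∈ OrderDual.ofDual q.1 then q.2 (Sum.inr g)
  else if S ∩ prot g = {p.mtx g} then q.2 (Sum.inr g) ⊔ η (.glob' g)
  else q.2 (Sum.inr g) ⊔ η (.glob g)

theorem le_pRead {q : PState X G D} :
    q.2 (Sum.inr g) ≤ pRead p prot η S q g := by
  unfold pRead
  split_ifs
  · exact le_rfl
  · exact le_sup_left
  · exact le_sup_left

theorem pRead_mono (hη : η ≤ ζ) {q q' : PState X G D} (hq : q ≤ q') :
    pRead p prot η S q g ≤ pRead p prot ζ S q' g := by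
  have hP : OrderDual.ofDual q'.1 ⊆ OrderDual.ofDual q.1 := hq.1
  have hσ : q.2 (Sum.inr g) ≤ q'.2 (Sum.inr g) := hq.2 _
  have hg : (η (.glob g) : D) ≤ ζ (.glob g) := hη (.glob g)
  have hg' : (η (.glob' g) : D) ≤ ζ (.glob' g) := hη (.glob' g)
  unfold pRead
  split_ifs with h1 h2
  · exact hσ
  · exact hσ.trans le_sup_left
  · exact hσ.trans le_sup_left
  · exact absurd (hP ‹_›) h1
  · exact sup_le_sup hσ hg'
  · exact absurd (hP ‹_›) h1
  · exact sup_le_sup hσ hg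

theorem pRhs_mono (hcomp : ∀ l, Monotone (comp l)) (hnu : ∀ u u₁, Monotone fun q => nu u q u₁)
    (heff : ∀ b ζ ⦃σ σ'⦄, σ ≤ σ' → Covers ζ (eff S b σ') → Covers ζ (eff S b σ))
    (A : Action N X G M L) (v : N) (S' : Set M) :
    Constraint.Mono (⟨.pt v S', pRhs p prot comp nu eff u S A⟩ :
      Constraint (PUnk N G M) (PVal N X G M D)) := by
  intro η η' hη
  have hpt : (η (.pt u S) : PState X G D) ≤ η' (.pt u S) := hη _
  have hP : OrderDual.ofDual (η' (.pt u S)).1 ⊆ OrderDual.ofDual (η (.pt u S)).1 := hpt.1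
  have hσ : (η (.pt u S)).2 ≤ (η' (.pt u S)).2 := hpt.2
  cases A with
  | comp l => exact ⟨fun _ _ => covers_empty, hP, compStore_mono (hcomp l) hσ⟩
  | create x u₁ =>
    have hchild : ((OrderDual.toDual ∅, childStore p.self (η (.pt u S)).2 (nu u (η (.pt u S)) u₁)) :
        PState X G D) ≤
        (OrderDual.toDual ∅, childStore p.self (η' (.pt u S)).2 (nu u (η' (.pt u S)) u₁)) :=
      ⟨le_rfl, childStore_mono hσ (hnu u u₁ hpt)⟩
    exact ⟨fun _ h => covers_singleton.2 (hchild.trans (covers_singleton.1 h)), hP,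
      override_mono hσ (hnu u u₁ hpt)⟩
  | lock a => exact ⟨fun _ _ => covers_empty, hpt⟩
  | unlock b => exact ⟨fun ζ => heff b ζ hσ, fun g hg => ⟨hP hg.1, hg.2⟩, hσ⟩
  | write g x =>
    exact ⟨fun _ _ => covers_empty, Set.union_subset_union_left _ hP, override_mono hσ (hσ _)⟩
  | read x g => exact ⟨fun _ _ => covers_empty, hP, override_mono hσ (pRead_mono hη hpt)⟩

theorem C₁_mono (hcomp : ∀ l, Monotone (comp l)) (hnu : ∀ u u₁, Monotone fun q => nu u q u₁) :
    ∀ c ∈ C₁ p prot comp nu, c.Mono := by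
  rintro c (rfl | ⟨u, S, A, v, _, _, _, rfl⟩)
  · exact fun _ _ _ => ⟨fun _ h => h, le_rfl⟩
  · exact pRhs_mono hcomp hnu (fun _ _ _ _ => Covers.unlockEff_mono) A v _

theorem isSolution_pSystem_iff :
    IsSolution (pSystem p prot comp nu eff) η ↔
      (OrderDual.toDual ∅, initStore X G) ≤ (η (.pt p.start ∅) : PState X G D) ∧
      ∀ u S A v, p.Reach u S → (u, A, v) ∈ p.edges → A.Enabled S →
        Covers η (pRhs p prot comp nu eff u S A η).1 ∧
        (pRhs p prot comp nu eff u S A η).2 ≤ (η (.pt v (A.post S)) : PState X G D) := by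
  constructor
  · intro h
    exact ⟨(h _ (Or.inl rfl)).2,
      fun u S A v hr he hen => h _ (Or.inr ⟨u, S, A, v, hr, he, hen, rfl⟩)⟩
  · rintro ⟨hinit, hstep⟩ c (rfl | ⟨u, S, A, v, hr, he, hen, rfl⟩)
    exacts [⟨covers_empty, hinit⟩, hstep u S A v hr he hen]

/-! ### The two systems have the same least solution -/

theorem IsSolution.pSystem_of_covers_unlock (hη : IsSolution (pSystem p prot comp nu eff) η)
    (h : ∀ u S b v, p.Reach u S → (u, Action.unlock b, v) ∈ p.edges → b ∈ S →
      Covers η (eff S b (η (.pt u S)).2) → Covers η (eff' S b (η (.pt u S)).2)) :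
    IsSolution (pSystem p prot comp nu eff') η := by
  obtain ⟨hinit, hstep⟩ := isSolution_pSystem_iff.1 hη
  refine isSolution_pSystem_iff.2 ⟨hinit, fun u S A v hr he hen => ?_⟩
  have hA := hstep u S A v hr he hen
  cases A with
  | unlock b => exact ⟨h u S b v hr he hen hA.1, hA.2⟩
  | comp | create | lock | write | read => exact hA

theorem IsSolution.C₁_of_C₁' (hη : IsSolution (C₁' p prot comp nu) η) :
    IsSolution (C₁ p prot comp nu) η := by
  refine hη.pSystem_of_covers_unlock fun u S b v _ _ _ hcov => ?_
  obtain ⟨h1, h2, h3⟩ := covers_unlockEff'_iff.1 hcov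
  refine covers_unlockEff_iff.2 ⟨fun g hb => h3 g (Or.inl ⟨g, hb.symm⟩), h2, fun g hb hg => h1 g ?_⟩
  exact fun hsub => (hsub ⟨hg, fun hbg => hb ⟨g, hbg.symm⟩⟩).2 rfl

/-- `η` with the value of `g` at the program points bounded by `d`, except at the locksets
satisfying `R`. -/
noncomputable def capStore (g : G) (R : Set M → Prop) (d : D) (η : PAssign N X G M D) :
    PAssign N X G M D
  | .pt u S => ((η (.pt u S)).1, override (η (.pt u S)).2 (Sum.inr g)
      ((η (.pt u S)).2 (Sum.inr g) ⊓ ⨅ _ : ¬ R S, d))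
  | .glob g => η (.glob g)
  | .glob' g => η (.glob' g)

theorem capStore_le (g : G) (R : Set M → Prop) (d : D) (η : PAssign N X G M D) :
    capStore g R d η ≤ η := by
  rintro (⟨u, S⟩ | h | h)
  · exact ⟨le_rfl, override_le_iff.2 ⟨inf_le_left, fun _ _ => le_rfl⟩⟩
  · exact (le_rfl : (η (.glob h) : D) ≤ _)
  · exact (le_rfl : (η (.glob' h) : D) ≤ _)

theorem le_capStore_pt {R : Set M → Prop} {d : D} {q : PState X G D} (h : q ≤ η (.pt u S))
    (hq : ¬ R S → q.2 (Sum.inr g) ≤ d) : q ≤ capStore g R d η (.pt u S) := by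
  refine ⟨h.1, fun y => ?_⟩
  by_cases hy : y = Sum.inr g
  · subst hy
    simpa [capStore] using ⟨h.2 (Sum.inr g), hq⟩
  · simpa [capStore, override_of_ne hy] using h.2 y

theorem capStore_pt_inr_le {R : Set M → Prop} {d : D} (hR : ¬ R S) :
    (capStore g R d η (.pt u S)).2 (Sum.inr g) ≤ d := by
  simp [capStore, hR]

theorem pRhs_store_inr {A : Action N X G M L} (hA : ∀ x, A ≠ .write g x) :
    (pRhs p prot comp nu eff u S A η).2.2 (Sum.inr g) = (η (.pt u S)).2 (Sum.inr g) := by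
  cases A with
  | write h x => exact override_of_ne fun hgh => hA x (by rw [Sum.inr.inj hgh])
  | create | read => exact override_of_ne Sum.inr_ne_inl
  | comp | lock | unlock => rfl

section Least

variable (hcomp : ∀ l, Monotone (comp l)) (hnu : ∀ u u₁, Monotone fun q => nu u q u₁)
  (hη : IsLeastSolution (C₁ p prot comp nu) η)

include hcomp hnu hη

-- By leastness, since capping the value of `g` by `d` outside of `R` preserves all constraints.
theorem IsLeastSolution.store_le_of_released {R : Set M → Prop} {d : D} (hR : Monotone R)
    (hwrite : ∀ u S x v, p.Reach u S → (u, Action.write g x, v) ∈ p.edges → R S)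
    (hunlock : ∀ u S b v, p.Reach u S → (u, Action.unlock b, v) ∈ p.edges → R S → ¬ R (S \ {b}) →
      Covers η (unlockEff p prot S b (η (.pt u S)).2) → (η (.pt u S)).2 (Sum.inr g) ≤ d)
    (hS : ¬ R S) : (η (.pt u S)).2 (Sum.inr g) ≤ d := by
  have hle := capStore_le g R d η
  suffices h : η ≤ capStore g R d η from
    ((h (.pt u S)).2 (Sum.inr g)).trans (capStore_pt_inr_le hS)
  refine IsLeastSolution.le_of_preserved (C₁_mono hcomp hnu) hη hle ?_
  rintro c (rfl | ⟨u, S, A, v, hr, he, hen, rfl⟩) hcov hval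
  · exact ⟨covers_empty, le_capStore_pt hval fun _ => bot_le⟩
  constructor
  · cases A with
    | create x u₁ =>
      exact covers_singleton.2 (le_capStore_pt (covers_singleton.1 hcov) fun _ => bot_le)
    | unlock b =>
      obtain ⟨h1, h2, h3⟩ := (covers_unlockEff_iff (S := S)).1 hcov
      exact (covers_unlockEff_iff (S := S)).2 ⟨h1, h2, h3⟩
    | comp | lock | write | read => exact covers_empty
  · refine le_capStore_pt hval fun hpost => ?_
    by_cases hA : ∃ x, A = .write g x
    · obtain ⟨x, rfl⟩ := hA
      exact absurd (hwrite u S x v hr he) hpost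
    rw [pRhs_store_inr fun x hx => hA ⟨x, hx⟩]
    by_cases hRS : R S
    · cases A with
      | unlock b =>
        exact ((hle (.pt u S)).2 _).trans
          (hunlock u S b v hr he hRS hpost
            ((isSolution_pSystem_iff.1 hη.1).2 u S _ v hr he hen).1)
      | lock a => exact absurd (hR Set.subset_union_left hRS) hpost
      | comp | create | write | read => exact absurd hRS hpost
    · exact capStore_pt_inr_le hRS

variable (hatomic : p.Atomic)

include hatomic

theorem IsLeastSolution.store_le_glob' (hg : p.mtx g ∉ S) :
    (η (.pt u S)).2 (Sum.inr g) ≤ (η (.glob' g) : D) := by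
  refine hη.store_le_of_released hcomp hnu (R := fun S => p.mtx g ∈ S)
    (fun _ _ hsub hmem => hsub hmem) (fun u S x v hr he => ?_) (fun u S b v hr he hmem _ hcov => ?_)
    hg
  · exact hr.mtx_mem_of_accesses hatomic he (Or.inl ⟨x, rfl⟩)
  · exact (covers_unlockEff_iff.1 hcov).1 g (hr.eq_mtx_of_unlock hatomic he hmem)

theorem IsLeastSolution.store_le_glob'_of_unlock {b : M} {v : N} (hr : p.Reach u S)
    (he : (u, Action.unlock b, v) ∈ p.edges) (hb : b ∈ S) (g : G) :
    (η (.pt u S)).2 (Sum.inr g) ≤ (η (.glob' g) : D) :=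
  (((isSolution_pSystem_iff.1 hη.1).2 u S _ v hr he hb).2.2 _).trans
    (hη.store_le_glob' hcomp hnu hatomic (hr.mtx_notMem_of_unlock hatomic he g))

theorem IsLeastSolution.glob_le_glob' (g : G) : (η (.glob g) : D) ≤ η (.glob' g) := by
  let ζ : PAssign N X G M D
    | .pt u S => η (.pt u S)
    | .glob g => (η (.glob g) ⊓ η (.glob' g) : D)
    | .glob' g => η (.glob' g)
  have hζ : ζ ≤ η := by
    rintro (⟨u, S⟩ | g | g)
    exacts [le_refl (α := PState X G D) _, inf_le_left (α := D), le_refl (α := D) _]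
  suffices h : η ≤ ζ from
    (show (η (.glob g) : D) ≤ η (.glob g) ⊓ η (.glob' g) from h (.glob g)).trans inf_le_right
  refine IsLeastSolution.le_of_preserved (C₁_mono hcomp hnu) hη hζ ?_
  rintro c (rfl | ⟨u, S, A, v, hr, he, hen, rfl⟩) hcov hval
  · exact ⟨covers_empty, hval⟩
  refine ⟨?_, hval⟩
  cases A with
  | create x u₁ => exact covers_singleton.2 (covers_singleton.1 hcov)
  | unlock b =>
    obtain ⟨h1, h2, h3⟩ := (covers_unlockEff_iff (S := S)).1 hcov
    exact (covers_unlockEff_iff (S := S)).2 ⟨h1, fun g hb hg => le_inf (h2 g hb hg) (h1 g hb),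
      fun g hb hg => le_inf (h3 g hb hg)
        (hη.store_le_glob'_of_unlock hcomp hnu hatomic hr he hen g)⟩
  | comp | lock | write | read => exact covers_empty

variable (hprot : p.WriteProtects prot)

include hprot

theorem IsLeastSolution.store_le_glob (hg : ¬ (prot g \ {p.mtx g} ⊆ S)) :
    (η (.pt u S)).2 (Sum.inr g) ≤ (η (.glob g) : D) := by
  refine hη.store_le_of_released hcomp hnu (R := fun S => p.Written g ∧ prot g \ {p.mtx g} ⊆ S)
    (fun _ _ hsub h => ⟨h.1, h.2.trans hsub⟩) (fun u S x v hr he => ?_)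
    (fun u S b v _ _ hR hnot hcov => ?_) fun h => hg h.2
  · exact ⟨⟨u, S, x, v, hr, he⟩, Set.sdiff_subset.trans (hprot.2 _ _ _ _ _ hr he)⟩
  · obtain ⟨a, ha, haS⟩ := Set.not_subset.1 fun hsub => hnot ⟨hR.1, hsub⟩
    obtain rfl : a = b := not_not.1 fun hab => haS ⟨hR.2 ha, hab⟩
    exact (covers_unlockEff_iff.1 hcov).2.2 g (hR.1.notMem_range_mtx hatomic hprot ha.1 ha.2) ha.1

theorem IsLeastSolution.isSolution_C₁' : IsSolution (C₁' p prot comp nu) η := by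
  refine hη.1.pSystem_of_covers_unlock fun u S b v hr he hb hcov => covers_unlockEff'_iff.2
    ⟨fun g hg => ?_, (covers_unlockEff_iff.1 hcov).2.1,
      fun g _ => hη.store_le_glob'_of_unlock hcomp hnu hatomic hr he hb g⟩
  exact (((isSolution_pSystem_iff.1 hη.1).2 u S _ v hr he hb).2.2 _).trans
    (hη.store_le_glob hcomp hnu hatomic hprot hg)

end Least

end ProtectionBased

/-! ### The induced solution of Write-Centered Reading -/

section UpLocks

variable {M : Type u} {B : Set (Set M)} {S T : Set M} {A : UpLocks M}

theorem upMem_upLocks : UpMem S (upLocks B) ↔ ∃ T ∈ B, T ⊆ S := Iff.rfl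

theorem upMem_upLocks_of_mem (h : S ∈ B) : UpMem S (upLocks B) := ⟨S, h, subset_rfl⟩

theorem upLocks_le_iff : upLocks B ≤ A ↔ ∀ S ∈ B, UpMem S A := by
  refine ⟨fun h S hS => h (subset_upperClosure hS), ?_⟩
  rintro h S ⟨T, hT, hTS⟩
  exact (OrderDual.ofDual A).upper hTS (h T hT)

theorem eq_of_minimal_upMem_upLocks_singleton
    (h : Minimal (fun T' => UpMem T' (upLocks {S})) T) : T = S := by
  obtain ⟨_, rfl, hle⟩ := h.1
  exact (h.2 (upMem_upLocks_of_mem rfl) hle).antisymm hle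

end UpLocks

section Relating

variable {N X G M L D : Type u} {p : Program N X G M L} {prot : G → Set M} {u v : N}
  {S S' w : Set M} {g : G} {a : M}

theorem upMem_gammaState_fst {q : PState X G D} :
    UpMem S ((gammaState prot q).1 g) ↔ prot g ⊆ S := by
  simp [gammaState, upMem_upLocks]

theorem upMem_gammaState_snd {q : PState X G D} :
    UpMem S ((gammaState prot q).2.1 g) ↔ (g ∈ OrderDual.ofDual q.1 → (S ∩ prot g).Nonempty) := by
  by_cases hg : g ∈ OrderDual.ofDual q.1
  · simp only [gammaState, hg, forall_const, if_true]
    constructor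
    · rintro ⟨_, ⟨a, ha, rfl⟩, haS⟩
      exact ⟨a, haS rfl, ha⟩
    · rintro ⟨a, haS, ha⟩
      exact ⟨{a}, ⟨a, ha, rfl⟩, Set.singleton_subset_iff.2 haS⟩
  · simp [gammaState, hg, upMem_upLocks]

variable [CompleteLattice D]

theorem le_gammaState_iff {s : WState X G M D} {q : PState X G D} :
    s ≤ gammaState prot q ↔ (∀ g S, UpMem S (s.1 g) → prot g ⊆ S) ∧
      (∀ g S, UpMem S (s.2.1 g) → g ∈ OrderDual.ofDual q.1 → (S ∩ prot g).Nonempty) ∧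
      s.2.2 ≤ q.2 :=
  ⟨fun h => ⟨fun g _ hS => (upMem_gammaState_fst (q := q)).1 (h.1 g hS),
      fun g _ hS => upMem_gammaState_snd.1 (h.2.1 g hS), h.2.2⟩,
    fun h => ⟨fun g _ hS => (upMem_gammaState_fst (q := q)).2 (h.1 g _ hS),
      fun g _ hS => upMem_gammaState_snd.2 (h.2.1 g _ hS), h.2.2⟩⟩

theorem gammaState_mono {q q' : PState X G D} (h : q ≤ q') :
    gammaState prot q ≤ gammaState prot q' :=
  le_gammaState_iff.2 ⟨fun _ _ => (upMem_gammaState_fst (q := q)).1,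
    fun _ _ hS hg => upMem_gammaState_snd.1 hS (h.1 hg), h.2⟩

theorem threadStart_le_gammaState {σ : Store X G D} {q : PState X G D}
    (h : (OrderDual.toDual ∅, σ) ≤ q) :
    ((fun _ => upLocks ∅, fun _ => upLocks {∅}, σ) : WState X G M D) ≤ gammaState prot q :=
  le_gammaState_iff.2 ⟨fun _ _ ⟨_, hT, _⟩ => hT.elim, fun _ _ _ hg => (h.1 hg).elim, h.2⟩

variable {η : PAssign N X G M D}

theorem describes_glob_or_glob' (hw : prot g ⊆ w) :
    Describes p prot (.glob g a S w) (.glob g : PUnk N G M) ∨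
      Describes p prot (.glob g a S w) (.glob' g : PUnk N G M) := by
  by_cases ha : a = p.mtx g ∨ a ∉ prot g
  · by_cases hS : prot g \ {p.mtx g} ⊆ S
    · exact Or.inr (.retained g a S w hw ha hS)
    · exact Or.inl (.released g a S w hw ha hS)
  · push Not at ha
    exact Or.inl (.own g a S w hw ⟨ha.2, ha.1⟩)

theorem eta₃_glob_eq_bot (hw : ¬ prot g ⊆ w) : (eta₃ p prot η (.glob g a S w) : D) = ⊥ :=
  (if_neg fun h => hw h.2.2).trans (if_pos hw)

theorem eta₃_eq_of_describes_glob
    (h : Describes p prot (.glob g a S w) (.glob g : PUnk N G M)) :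
    (eta₃ p prot η (.glob g a S w) : D) = η (.glob g) := by
  cases h with
  | own _ _ _ _ hw ha =>
    exact (if_neg fun h => h.1.elim ha.2 fun h' => h' ha.1).trans (if_neg (not_not.2 hw))
  | released _ _ _ _ hw ha hS => exact (if_neg fun h => hS h.2.1).trans (if_neg (not_not.2 hw))

theorem eta₃_eq_of_describes_glob'
    (h : Describes p prot (.glob g a S w) (.glob' g : PUnk N G M)) :
    (eta₃ p prot η (.glob g a S w) : D) = η (.glob' g) := by
  cases h with
  | retained _ _ _ _ hw ha hS => exact if_pos ⟨ha, hS, hw⟩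

theorem Covers.le_glob_of_describes {σ : Store X G D} (h : Covers η (unlockEff' p prot S a σ))
    (hd : Describes p prot (.glob g a (S \ {a}) w) (.glob g : PUnk N G M)) :
    σ (Sum.inr g) ≤ (η (.glob g) : D) := by
  refine (covers_unlockEff'_iff.1 h).1 g ?_
  cases hd with
  | own _ _ _ _ _ ha => exact fun hsub => (hsub ha).2 rfl
  | released _ _ _ _ _ _ hS => exact hS

theorem Covers.le_glob'_of_describes {σ : Store X G D} (h : Covers η (unlockEff' p prot S a σ))
    (hd : Describes p prot (.glob g a (S \ {a}) w) (.glob' g : PUnk N G M)) :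
    σ (Sum.inr g) ≤ (η (.glob' g) : D) := by
  refine (covers_unlockEff'_iff.1 h).2.2 g ?_
  cases hd with
  | retained _ _ _ _ _ ha _ => exact ha.imp_left fun hag => ⟨g, hag.symm⟩

/-- The value obtained by reading `g` in the state `s` at lockset `S` in the Write-Centered
system. -/
noncomputable def wRead (ζ : WAssign N X G M D) (S : Set M) (s : WState X G M D) (g : G) : D :=
  s.2.2 (Sum.inr g) ⊔
    sSup {d | ∃ a S' w, a ∈ S ∧ S ∩ S' = ∅ ∧ (∃ S'', UpMem S'' (s.2.1 g) ∧ S'' ∩ w = ∅) ∧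
      (∃ S''', UpMem S''' (s.2.1 g) ∧ a ∉ S''') ∧ d = ζ (.glob g a S' w)}

theorem wRead_eta₃_le_pRead (hmtx : p.mtx g ∈ S ∩ prot g)
    (hle : (η (.glob g) : D) ≤ η (.glob' g)) (q : PState X G D) :
    wRead (eta₃ p prot η) S (gammaState prot q) g ≤ pRead p prot η S q g := by
  refine sup_le le_pRead (sSup_le ?_)
  rintro _ ⟨a, S', w, -, hSS', ⟨T, hT, hTw⟩, -, rfl⟩
  by_cases hw : prot g ⊆ w
  swap
  · exact (eta₃_glob_eq_bot hw).le.trans bot_le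
  have hgP : g ∉ OrderDual.ofDual q.1 := fun hg => by
    obtain ⟨b, hbT, hb⟩ := upMem_gammaState_snd.1 hT hg
    exact Set.eq_empty_iff_forall_notMem.1 hTw b ⟨hbT, hw hb⟩
  rw [pRead, if_neg hgP]
  rcases describes_glob_or_glob' (p := p) hw with hd | hd
  · rw [eta₃_eq_of_describes_glob hd]
    split_ifs
    exacts [hle.trans le_sup_right, le_sup_right]
  · have hprot : S ∩ prot g = {p.mtx g} := by
      cases hd with
      | retained _ _ _ _ _ _ hS' =>
        refine (Set.singleton_subset_iff.2 hmtx).antisymm' fun b hb => ?_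
        by_contra hne
        exact Set.eq_empty_iff_forall_notMem.1 hSS' b ⟨hb.1, hS' ⟨hb.2, hne⟩⟩
    rw [eta₃_eq_of_describes_glob' hd, if_pos hprot]
    exact le_sup_right

variable {comp : L → (X → D) → (X → D)} {nu₁ : N → PState X G D → N → D}
  {nu₃ : N → WState X G M D → N → D} {A : Action N X G M L}
  {eff : Set M → M → Store X G D → Set ((y : PUnk N G M) × PVal N X G M D y)}

theorem wRhs_write_eta₃_le {x : X} (hS : prot g ⊆ S) (hmtx : p.mtx g ∈ prot g) :
    (wRhs p comp nu₃ u S (.write g x) (eta₃ p prot η)).2 ≤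
      gammaState prot (pRhs p prot comp nu₁ eff u S (.write g x) η).2 := by
  refine le_gammaState_iff.2 ⟨fun h T hT => ?_, fun h T hT hP => ?_, le_rfl⟩ <;>
    by_cases hgh : h = g
  · subst hgh
    simp only [wRhs, override_same] at hT
    obtain ⟨_, rfl, hST⟩ := hT
    exact hS.trans hST
  · simp only [wRhs, override_of_ne hgh] at hT
    exact (upMem_gammaState_fst (q := η (.pt u S))).1 hT
  · subst hgh
    simp only [wRhs, override_same] at hT
    obtain ⟨_, rfl, hST⟩ := hT
    exact ⟨p.mtx h, hST (hS hmtx), hmtx⟩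
  · simp only [wRhs, override_of_ne hgh] at hT
    exact upMem_gammaState_snd.1 hT (hP.resolve_right hgh)

theorem wRhs_unlock_eta₃_le :
    (wRhs p comp nu₃ u S (.unlock a) (eta₃ p prot η)).2 ≤
      gammaState prot (pRhs p prot comp nu₁ eff u S (.unlock a) η).2 := by
  refine le_gammaState_iff.2 ⟨fun _ _ => (upMem_gammaState_fst (q := η (.pt u S))).1,
    fun h T hT hP => ?_, le_rfl⟩
  rcases hT with hT | ⟨_, rfl, hST⟩
  · exact upMem_gammaState_snd.1 hT hP.1
  · exact hP.2.mono (Set.inter_subset_inter_left _ hST)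

theorem wRhs_eta₃_le (hatomic : p.Atomic) (hprot : p.WriteProtects prot)
    (hnu : ∀ u q u₁, nu₃ u (gammaState prot q) u₁ ≤ nu₁ u q u₁)
    (hle : ∀ g, (η (.glob g) : D) ≤ η (.glob' g)) (hr : p.Reach u S) (he : (u, A, v) ∈ p.edges) :
    (wRhs p comp nu₃ u S A (eta₃ p prot η)).2 ≤
      gammaState prot (pRhs p prot comp nu₁ eff u S A η).2 := by
  cases A with
  | comp | lock => exact le_rfl
  | create x u₁ => exact ⟨le_rfl, le_rfl, override_mono le_rfl (hnu u _ u₁)⟩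
  | unlock a => exact wRhs_unlock_eta₃_le
  | write g x => exact wRhs_write_eta₃_le (hprot.2 _ _ _ _ _ hr he) (hprot.1 g)
  | read x g =>
    exact ⟨le_rfl, le_rfl, override_mono le_rfl (wRead_eta₃_le_pRead
      ⟨hr.mtx_mem_of_accesses hatomic he (Or.inr ⟨x, rfl⟩), hprot.1 g⟩ (hle g) _)⟩

theorem Covers.wRhs_eta₃ (hnu : ∀ u q u₁, nu₃ u (gammaState prot q) u₁ ≤ nu₁ u q u₁)
    (h : Covers η (pRhs p prot comp nu₁ (unlockEff' p prot) u S A η).1) :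
    Covers (eta₃ p prot η) (wRhs p comp nu₃ u S A (eta₃ p prot η)).1 := by
  cases A with
  | comp | lock | write | read => exact covers_empty
  | create x u₁ =>
    refine covers_singleton.2 ((threadStart_le_gammaState (covers_singleton.1 h)).trans' ?_)
    exact ⟨le_rfl, le_rfl, childStore_mono le_rfl (hnu u _ u₁)⟩
  | unlock a =>
    rintro _ ⟨g, w, hw, rfl⟩
    obtain rfl := eq_of_minimal_upMem_upLocks_singleton hw
    rcases describes_glob_or_glob' (p := p) (S := S \ {a}) (a := a) (subset_refl (prot g))
      with hd | hd
    · exact (Covers.le_glob_of_describes h hd).trans (eta₃_eq_of_describes_glob hd).ge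
    · exact (Covers.le_glob'_of_describes h hd).trans (eta₃_eq_of_describes_glob' hd).ge

theorem IsSolution.eta₃ (hatomic : p.Atomic) (hprot : p.WriteProtects prot)
    (hnu : ∀ u q u₁, nu₃ u (gammaState prot q) u₁ ≤ nu₁ u q u₁)
    (hη : IsSolution (C₁' p prot comp nu₁) η) (hle : ∀ g, (η (.glob g) : D) ≤ η (.glob' g)) :
    IsSolution (C₃ p comp nu₃) (eta₃ p prot η) := by
  obtain ⟨hinit, hstep⟩ := isSolution_pSystem_iff.1 hη
  rintro c (rfl | ⟨u, S, A, v, hr, he, hen, rfl⟩)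
  · exact ⟨covers_empty, threadStart_le_gammaState hinit⟩
  · have hA := hstep u S A v hr he hen
    exact ⟨Covers.wRhs_eta₃ hnu hA.1,
      (wRhs_eta₃_le hatomic hprot hnu hle hr he).trans (gammaState_mono hA.2)⟩

end Relating

/-! ### Causality in global traces -/

namespace Trace

variable {N X G M L V : Type u} {p : Program N X G M L} {sem : Semantics N X G M L V}
  {t : Trace N X G M L V} {z : Node N X V}

theorem le_refl (n : Node N X V) : t.le n n := Relation.ReflTransGen.refl

theorem le_trans {k m n : Node N X V} (h : t.le k m) (h' : t.le m n) : t.le k n :=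
  Relation.ReflTransGen.trans h h'

theorem le_of_edge {m n : Node N X V} {A : Action N X G M L} (h : (m, A, n) ∈ t.edges) :
    t.le m n := Relation.ReflTransGen.single (Or.inl ⟨A, h⟩)

theorem le_of_created {m n : Node N X V} (h : t.created m n) : t.le m n :=
  Relation.ReflTransGen.single (Or.inr (Or.inl h))

theorem le_of_locked {m n : Node N X V} {a : M} (h : t.locked a m n) : t.le m n :=
  Relation.ReflTransGen.single (Or.inr (Or.inr ⟨a, h⟩))

theorem mem_lockset_of_lock {m n : Node N X V} {a : M} (he : (m, Action.lock a, n) ∈ t.edges) :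
    a ∈ t.lockset p n :=
  ⟨m, n, he, rfl, le_rfl, fun _ _ _ _ hlt hle => absurd hle (Nat.not_le.2 hlt)⟩

/-- The graph `t` consists of the raw traces `r i` of the finitely many threads `i ∈ I`. It spells
out the unions in `IsGlobal.raw`. -/
structure IsThreading (p : Program N X G M L) (sem : Semantics N X G M L V)
    (t : Trace N X G M L V) (I : Set V) (r : V → RawTrace N X G M L V) : Prop where
  finite : I.Finite
  isRaw : ∀ i ∈ I, (r i).IsRaw p sem i
  mem_nodes_iff : ∀ n, n ∈ t.nodes ↔ ∃ i ∈ I, ∃ j ≤ (r i).len, n = (r i).node j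
  mem_edges_iff : ∀ m A n, (m, A, n) ∈ t.edges ↔
    ∃ i ∈ I, ∃ j < (r i).len, m = (r i).node j ∧ A = (r i).act j ∧ n = (r i).node (j + 1)

theorem isThreading_iff {I : Set V} {r : V → RawTrace N X G M L V} :
    t.IsThreading p sem I r ↔ I.Finite ∧ (∀ i ∈ I, (r i).IsRaw p sem i) ∧
      t.nodes = (⋃ i ∈ I, (r i).nodes) ∧ t.edges = ⋃ i ∈ I, (r i).edges := by
  have hnodes : t.nodes = (⋃ i ∈ I, (r i).nodes) ↔
      ∀ n, n ∈ t.nodes ↔ ∃ i ∈ I, ∃ j ≤ (r i).len, n = (r i).node j := by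
    simp only [Set.ext_iff, Set.mem_iUnion, exists_prop, RawTrace.nodes, Set.mem_ofPred_eq]
  have hedges : t.edges = (⋃ i ∈ I, (r i).edges) ↔ ∀ m A n, (m, A, n) ∈ t.edges ↔
      ∃ i ∈ I, ∃ j < (r i).len, m = (r i).node j ∧ A = (r i).act j ∧ n = (r i).node (j + 1) := by
    simp only [Set.ext_iff, Set.mem_iUnion, exists_prop, RawTrace.edges, Set.mem_ofPred_eq,
      Prod.forall, Prod.mk.injEq]
  rw [hnodes, hedges]
  exact ⟨fun h => ⟨h.1, h.2, h.3, h.4⟩, fun h => ⟨h.1, h.2.1, h.2.2.1, h.2.2.2⟩⟩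

namespace IsGlobal

section

variable (h : t.IsGlobal p sem z)
include h

theorem exists_isThreading : ∃ I r, t.IsThreading p sem I r := by
  obtain ⟨I, r, hr⟩ := h.raw
  exact ⟨I, r, isThreading_iff.2 hr⟩

theorem finite_nodes : t.nodes.Finite := by
  obtain ⟨I, r, hr⟩ := h.exists_isThreading
  refine (hr.finite.biUnion fun i _ => (Set.finite_Iic (r i).len).image (r i).node).subset ?_
  intro n hn
  obtain ⟨i, hi, j, hj, rfl⟩ := (hr.mem_nodes_iff n).1 hn
  exact Set.mem_biUnion hi ⟨j, hj, rfl⟩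

theorem node_ext {m n : Node N X V} (hm : m ∈ t.nodes) (hn : n ∈ t.nodes)
    (hs : m.st p.self = n.st p.self) (hi : m.idx = n.idx) : m = n := by
  obtain ⟨I, r, hr⟩ := h.exists_isThreading
  obtain ⟨i, hiI, j, hj, rfl⟩ := (hr.mem_nodes_iff m).1 hm
  obtain ⟨i', hiI', j', hj', rfl⟩ := (hr.mem_nodes_iff n).1 hn
  obtain rfl : i = i' := by
    rw [← (hr.isRaw i hiI).1 j hj, ← (hr.isRaw i' hiI').1 j' hj']
    exact hs
  obtain rfl : j = j' := hi
  rfl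

end

section

variable {m n : Node N X V} {A : Action N X G M L} (h : t.IsGlobal p sem z)
  (he : (m, A, n) ∈ t.edges)
include h he

theorem edge_source_mem : m ∈ t.nodes := by
  obtain ⟨I, r, hr⟩ := h.exists_isThreading
  obtain ⟨i, hi, j, hj, rfl, -⟩ := (hr.mem_edges_iff _ _ _).1 he
  exact (hr.mem_nodes_iff _).2 ⟨i, hi, j, hj.le, rfl⟩

theorem edge_target_mem : n ∈ t.nodes := by
  obtain ⟨I, r, hr⟩ := h.exists_isThreading
  obtain ⟨i, hi, j, hj, -, -, rfl⟩ := (hr.mem_edges_iff _ _ _).1 he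
  exact (hr.mem_nodes_iff _).2 ⟨i, hi, j + 1, hj, rfl⟩

theorem edge_idx : n.idx = m.idx + 1 := by
  obtain ⟨I, r, hr⟩ := h.exists_isThreading
  obtain ⟨i, -, j, -, rfl, -, rfl⟩ := (hr.mem_edges_iff _ _ _).1 he
  rfl

theorem edge_self : m.st p.self = n.st p.self := by
  obtain ⟨I, r, hr⟩ := h.exists_isThreading
  obtain ⟨i, hi, j, hj, rfl, -, rfl⟩ := (hr.mem_edges_iff _ _ _).1 he
  exact ((hr.isRaw i hi).1 j hj.le).trans ((hr.isRaw i hi).1 (j + 1) hj).symm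

theorem edge_mem_program : (m.pt, A, n.pt) ∈ p.edges := by
  obtain ⟨I, r, hr⟩ := h.exists_isThreading
  obtain ⟨i, hi, j, hj, rfl, rfl, rfl⟩ := (hr.mem_edges_iff _ _ _).1 he
  exact ((hr.isRaw i hi).2 j hj).1

theorem edge_localStep : LocalStep sem m.st A n.st := by
  obtain ⟨I, r, hr⟩ := h.exists_isThreading
  obtain ⟨i, hi, j, hj, rfl, rfl, rfl⟩ := (hr.mem_edges_iff _ _ _).1 he
  exact ((hr.isRaw i hi).2 j hj).2

theorem edge_source_ne : m ≠ n := by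
  rintro rfl
  have := h.edge_idx he
  omega

theorem edge_eq_of_idx_eq {m' n' : Node N X V} {A' : Action N X G M L}
    (he' : (m', A', n') ∈ t.edges) (hs : n.st p.self = n'.st p.self) (hi : n.idx = n'.idx) :
    m = m' ∧ A = A' ∧ n = n' := by
  have hi₁ := h.edge_idx he
  have hi₂ := h.edge_idx he'
  obtain rfl : n = n' := h.node_ext (h.edge_target_mem he) (h.edge_target_mem he') hs hi
  obtain rfl : m = m' := h.node_ext (h.edge_source_mem he) (h.edge_source_mem he')
    ((h.edge_self he).trans (h.edge_self he').symm) (by omega)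
  refine ⟨rfl, ?_, rfl⟩
  obtain ⟨I, r, hr⟩ := h.exists_isThreading
  obtain ⟨i, hiI, j, hj, rfl, rfl, -⟩ := (hr.mem_edges_iff _ _ _).1 he
  obtain ⟨i', hiI', j', hj', hm, rfl, -⟩ := (hr.mem_edges_iff _ _ _).1 he'
  obtain rfl : j = j' := congrArg Node.idx hm
  obtain rfl : i = i' := by
    rw [← (hr.isRaw i hiI).1 j hj.le, ← (hr.isRaw i' hiI').1 j hj'.le]
    exact congrArg (fun k => k.st p.self) hm
  rfl

theorem idx_le_source_of_ne {k l : Node N X V} {B : Action N X G M L} (hl : (k, B, l) ∈ t.edges)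
    (hBA : B ≠ A) (hs : l.st p.self = n.st p.self) (hi : l.idx ≤ n.idx) : l.idx ≤ m.idx := by
  by_contra hlt
  have hmn := h.edge_idx he
  exact hBA (h.edge_eq_of_idx_eq hl he hs (by omega)).2.1

end

variable (h : t.IsGlobal p sem z)
include h

theorem exists_edge_to {n : Node N X V} (hn : n ∈ t.nodes) (h0 : n.idx ≠ 0) :
    ∃ m A, (m, A, n) ∈ t.edges := by
  obtain ⟨I, r, hr⟩ := h.exists_isThreading
  obtain ⟨i, hi, j, hj, rfl⟩ := (hr.mem_nodes_iff n).1 hn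
  obtain ⟨j, rfl⟩ := Nat.exists_eq_succ_of_ne_zero (show j ≠ 0 from h0)
  exact ⟨_, _, (hr.mem_edges_iff _ _ _).2 ⟨i, hi, j, hj, rfl, rfl, rfl⟩⟩

theorem le_of_idx_le {m n : Node N X V} (hm : m ∈ t.nodes) (hn : n ∈ t.nodes)
    (hs : m.st p.self = n.st p.self) (hi : m.idx ≤ n.idx) : t.le m n := by
  obtain ⟨d, hd⟩ := Nat.exists_eq_add_of_le hi
  induction d generalizing n with
  | zero => rw [h.node_ext hm hn hs hd.symm]; exact le_refl n
  | succ d ih =>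
    obtain ⟨k, A, he⟩ := h.exists_edge_to hn (by omega)
    have hkn := h.edge_idx he
    exact le_trans (ih (h.edge_source_mem he) (hs.trans (h.edge_self he).symm) (by omega)
      (by omega)) (le_of_edge he)

theorem le_iff_idx_le {m n : Node N X V} (hm : m ∈ t.nodes) (hn : n ∈ t.nodes)
    (hs : m.st p.self = n.st p.self) : t.le m n ↔ m.idx ≤ n.idx := by
  refine ⟨fun hle => ?_, h.le_of_idx_le hm hn hs⟩
  rcases Nat.le_total m.idx n.idx with hi | hi
  · exact hi
  · rw [h.antisymm m n hle (h.le_of_idx_le hn hm hs.symm hi)]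

theorem exists_edge_from {m n : Node N X V} (hm : m ∈ t.nodes) (hn : n ∈ t.nodes)
    (hs : m.st p.self = n.st p.self) (hi : m.idx < n.idx) : ∃ A k, (m, A, k) ∈ t.edges := by
  obtain ⟨I, r, hr⟩ := h.exists_isThreading
  obtain ⟨i, hiI, j, hj, rfl⟩ := (hr.mem_nodes_iff m).1 hm
  obtain ⟨i', hiI', j', hj', rfl⟩ := (hr.mem_nodes_iff n).1 hn
  obtain rfl : i = i' := by
    rw [← (hr.isRaw i hiI).1 j hj, ← (hr.isRaw i' hiI').1 j' hj']
    exact hs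
  exact ⟨_, _, (hr.mem_edges_iff _ _ _).2 ⟨i, hiI, j, Nat.lt_of_lt_of_le hi hj', rfl, rfl, rfl⟩⟩

theorem locked_target_mem {m n : Node N X V} {a : M} (hl : t.locked a m n) : n ∈ t.nodes := by
  obtain ⟨k, hk⟩ := (h.locked_dom a m n hl).2
  exact h.edge_target_mem hk

theorem locked_source_mem {m n : Node N X V} {a : M} (hl : t.locked a m n) : m ∈ t.nodes := by
  rcases (h.locked_dom a m n hl).1 with rfl | ⟨k, hk⟩
  · exact h.init.1
  · exact h.edge_target_mem hk

theorem node_induction {Q : Node N X V → Prop}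
    (ih : ∀ n ∈ t.nodes, (∀ k ∈ t.nodes, t.le k n → k ≠ n → Q k) → Q n) :
    ∀ n ∈ t.nodes, Q n := by
  suffices H : ∀ (c : ℕ), ∀ n ∈ t.nodes, {k ∈ t.nodes | t.le k n}.ncard < c → Q n from
    fun n hn => H _ n hn (Nat.lt_succ_self _)
  intro c
  induction c with
  | zero => exact fun n _ hc => absurd hc (Nat.not_lt_zero _)
  | succ c hc =>
    intro n hn hlt
    refine ih n hn fun k hk hle hne => hc k hk (lt_of_lt_of_le ?_ (Nat.lt_succ_iff.1 hlt))
    refine Set.ncard_lt_ncard ⟨fun l hl => ⟨hl.1, le_trans hl.2 hle⟩, fun hsub => ?_⟩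
      (h.finite_nodes.subset (Set.sep_subset _ _))
    exact hne (h.antisymm _ _ hle (hsub ⟨hn, le_refl n⟩).2)

theorem created_ne {m s : Node N X V} (hc : t.created m s) : m ≠ s := by
  rintro rfl
  obtain ⟨hm, -, h0, hz, -⟩ := h.created_dom m m hc
  suffices H : ∀ n, t.le z n → n ≠ m from H m (h.least m hm) rfl
  intro n hn
  induction hn with
  | refl => exact hz.symm
  | @tail b c _ hstep ih =>
    rintro rfl
    rcases hstep with ⟨A, he⟩ | hc' | ⟨a, hl⟩
    · have := h.edge_idx he
      omega
    · exact ih ((h.created_unique c hm h0 hz).unique hc' hc)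
    · obtain ⟨k, hk⟩ := (h.locked_dom _ _ _ hl).2
      have := h.edge_idx hk
      omega

/-! ### Locksets -/

theorem lockset_of_idx_zero {n : Node N X V} (h0 : n.idx = 0) : t.lockset p n = ∅ := by
  refine Set.eq_empty_of_forall_notMem ?_
  rintro a ⟨m, m', he, -, hi, -⟩
  have := h.edge_idx he
  omega

theorem mem_lockset_of_mem_source {m n : Node N X V} {A : Action N X G M L} {a : M}
    (he : (m, A, n) ∈ t.edges) (hA : A ≠ .unlock a) (ha : a ∈ t.lockset p m) :
    a ∈ t.lockset p n := by
  obtain ⟨k, k', hk, hks, hki, hno⟩ := ha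
  have hi := h.edge_idx he
  have hs := h.edge_self he
  exact ⟨k, k', hk, hks.trans hs, by omega, fun l l' hl hls hli hle =>
    hno l l' hl (hls.trans hs.symm) hli (h.idx_le_source_of_ne he hl hA.symm hls hle)⟩

theorem mem_lockset_source {m n : Node N X V} {A : Action N X G M L} {a : M}
    (he : (m, A, n) ∈ t.edges) (hA : A ≠ .lock a) (ha : a ∈ t.lockset p n) :
    a ∈ t.lockset p m := by
  obtain ⟨k, k', hk, hks, hki, hno⟩ := ha
  have hi := h.edge_idx he
  have hs := h.edge_self he
  exact ⟨k, k', hk, hks.trans hs.symm, h.idx_le_source_of_ne he hk hA.symm hks hki,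
    fun l l' hl hls hli hle => hno l l' hl (hls.trans hs) hli (by omega)⟩

theorem notMem_lockset_of_unlock {m n : Node N X V} {a : M}
    (he : (m, Action.unlock a, n) ∈ t.edges) : a ∉ t.lockset p n := by
  rintro ⟨k, k', hk, hks, hki, hno⟩
  have hi := h.edge_idx he
  have hkm := h.idx_le_source_of_ne he hk (by simp) hks hki
  exact hno m n he rfl (by omega) le_rfl

theorem lockset_step {m n : Node N X V} {A : Action N X G M L} (he : (m, A, n) ∈ t.edges) :
    t.lockset p n = A.post (t.lockset p m) := by
  ext a
  constructor
  · intro ha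
    by_contra hpost
    by_cases ham : a ∈ t.lockset p m
    · obtain rfl := A.eq_unlock_of_notMem_post hpost ham
      exact h.notMem_lockset_of_unlock he ha
    · refine ham (h.mem_lockset_source he ?_ ha)
      rintro rfl
      exact hpost (Or.inr rfl)
  · intro ha
    by_cases ham : a ∈ t.lockset p m
    · refine h.mem_lockset_of_mem_source he ?_ ham
      rintro rfl
      exact ha.2 rfl
    · obtain rfl := A.eq_lock_of_mem_post ha ham
      exact mem_lockset_of_lock he

theorem reach {n : Node N X V} (hn : n ∈ t.nodes) : p.Reach n.pt (t.lockset p n) := by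
  refine h.node_induction (Q := fun n => p.Reach n.pt (t.lockset p n)) ?_ n hn
  intro n hn ih
  by_cases h0 : n.idx = 0
  · rw [h.lockset_of_idx_zero h0]
    by_cases hz : n = z
    · rw [hz, h.init.2.2.1]
      exact .start
    · obtain ⟨m, hm, -⟩ := h.created_unique n hn h0 hz
      obtain ⟨hmn, -, -, -, ⟨x, v, he⟩, -⟩ := h.created_dom m n hm
      exact .spawn (ih m hmn (le_of_created hm) (h.created_ne hm)) he
  · obtain ⟨m, A, he⟩ := h.exists_edge_to hn h0
    rw [h.lockset_step he]
    exact .step (ih m (h.edge_source_mem he) (le_of_edge he) (h.edge_source_ne he))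
      (h.edge_mem_program he) (h.enabled _ _ _ he)

end IsGlobal

/-! ### Mutual exclusion -/

/-- The mutex `a`, acquired at `m`, is still held at `n` by the same thread. -/
structure HeldFrom (p : Program N X G M L) (t : Trace N X G M L V) (a : M) (m n : Node N X V) :
    Prop where
  lock : ∃ k, (k, Action.lock a, m) ∈ t.edges
  self_eq : m.st p.self = n.st p.self
  idx_le : m.idx ≤ n.idx
  not_unlock : ∀ k k', (k, Action.unlock a, k') ∈ t.edges → k'.st p.self = n.st p.self →
    m.idx < k'.idx → ¬ k'.idx ≤ n.idx

theorem mem_lockset_iff_exists_heldFrom {a : M} {n : Node N X V} :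
    a ∈ t.lockset p n ↔ ∃ m, t.HeldFrom p a m n :=
  ⟨fun ⟨k, m, hk, hs, hi, hno⟩ => ⟨m, ⟨k, hk⟩, hs, hi, hno⟩,
    fun ⟨m, ⟨k, hk⟩, hs, hi, hno⟩ => ⟨k, m, hk, hs, hi, hno⟩⟩

/-- `q` is the node where the thread of `n` releases the mutex `a` for the first time after `n`. -/
structure Releases (p : Program N X G M L) (t : Trace N X G M L V) (a : M) (n q : Node N X V) :
    Prop where
  unlock : ∃ k, (k, Action.unlock a, q) ∈ t.edges
  self_eq : q.st p.self = n.st p.self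
  idx_lt : n.idx < q.idx
  idx_le : ∀ k' q', (k', Action.unlock a, q') ∈ t.edges → q'.st p.self = n.st p.self →
    n.idx < q'.idx → q.idx ≤ q'.idx

/-- The thread of `c` releases the mutex `a` after `c` and causally before `d`. -/
def ReleasedBetween (p : Program N X G M L) (t : Trace N X G M L V) (a : M) (c d : Node N X V) :
    Prop :=
  ∃ k q, (k, Action.unlock a, q) ∈ t.edges ∧ q.st p.self = c.st p.self ∧ c.idx < q.idx ∧ t.le q d

/-- The acquisition `m'` of the mutex `a` is the next one after the acquisition `m`. -/
def NextLock (p : Program N X G M L) (t : Trace N X G M L V) (a : M) (m m' : Node N X V) : Prop :=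
  ∃ q, t.Releases p a m q ∧ t.locked a q m'

namespace IsGlobal

variable (h : t.IsGlobal p sem z)
include h

theorem releases_unique {a : M} {n q q' : Node N X V} (hq : t.Releases p a n q)
    (hq' : t.Releases p a n q') : q = q' := by
  obtain ⟨k, hk⟩ := hq.unlock
  obtain ⟨k', hk'⟩ := hq'.unlock
  exact h.node_ext (h.edge_target_mem hk) (h.edge_target_mem hk')
    (hq.self_eq.trans hq'.self_eq.symm) (le_antisymm
      (hq.idx_le _ _ hk' hq'.self_eq hq'.idx_lt) (hq'.idx_le _ _ hk hq.self_eq hq.idx_lt))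

theorem nextLock_rightUnique {a : M} : Relator.RightUnique (t.NextLock p a) := by
  rintro m n n' ⟨q, hq, hqn⟩ ⟨q', hq', hqn'⟩
  obtain rfl := h.releases_unique hq hq'
  exact h.locked_inj _ _ _ _ hqn hqn'

theorem le_of_releases {a : M} {n q : Node N X V} (hn : n ∈ t.nodes) (hq : t.Releases p a n q) :
    t.le n q := by
  obtain ⟨k, hk⟩ := hq.unlock
  exact h.le_of_idx_le hn (h.edge_target_mem hk) hq.self_eq.symm hq.idx_lt.le

theorem ne_of_nextLock {a : M} {m n : Node N X V} (hm : m ∈ t.nodes) (hmn : t.NextLock p a m n) :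
    m ≠ n := by
  rintro rfl
  obtain ⟨q, hq, hqm⟩ := hmn
  have hmq := h.antisymm m q (h.le_of_releases hm hq) (le_of_locked hqm)
  exact hq.idx_lt.ne (congrArg Node.idx hmq)

theorem le_of_nextLock_chain {a : M} {m n : Node N X V} (hm : m ∈ t.nodes)
    (hmn : Relation.ReflTransGen (t.NextLock p a) m n) : n ∈ t.nodes ∧ t.le m n := by
  induction hmn with
  | refl => exact ⟨hm, le_refl m⟩
  | tail _ hstep ih =>
    obtain ⟨q, hq, hqn⟩ := hstep
    exact ⟨h.locked_target_mem hqn,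
      le_trans ih.2 (le_trans (h.le_of_releases ih.1 hq) (le_of_locked hqn))⟩

theorem exists_nextLock_of_unlock {a : M} {l q n : Node N X V}
    (hq : (l, Action.unlock a, q) ∈ t.edges) (hqn : t.locked a q n) :
    ∃ m, (∃ k, (k, Action.lock a, m) ∈ t.edges) ∧ t.NextLock p a m n := by
  obtain ⟨m, hml⟩ := mem_lockset_iff_exists_heldFrom.1 (h.enabled _ _ _ hq : a ∈ t.lockset p l)
  have hlq := h.edge_idx hq
  have hml' := hml.idx_le
  refine ⟨m, hml.lock, q, ⟨⟨l, hq⟩, (hml.self_eq.trans (h.edge_self hq)).symm, by omega, ?_⟩, hqn⟩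
  intro k' q' hq' hs hi
  have := hml.not_unlock k' q' hq' (hs.trans hml.self_eq) hi
  omega

theorem exists_nextLock_chain {a : M} {n : Node N X V}
    (hn : ∃ k, (k, Action.lock a, n) ∈ t.edges) :
    ∃ f, t.locked a z f ∧ Relation.ReflTransGen (t.NextLock p a) f n := by
  obtain ⟨k, hk⟩ := hn
  refine h.node_induction (Q := fun n => ∀ k, (k, Action.lock a, n) ∈ t.edges →
    ∃ f, t.locked a z f ∧ Relation.ReflTransGen (t.NextLock p a) f n)
    ?_ n (h.edge_target_mem hk) k hk
  intro n _ ih k hk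
  obtain ⟨q, hq, -⟩ := h.locked_unique a k n hk
  rcases (h.locked_dom a q n hq).1 with rfl | ⟨l, hl⟩
  · exact ⟨n, hq, .refl⟩
  obtain ⟨m, ⟨k', hk'⟩, hmn⟩ := h.exists_nextLock_of_unlock hl hq
  have hm := h.edge_target_mem hk'
  obtain ⟨f, hf, hfm⟩ := ih m hm (h.le_of_nextLock_chain hm (.single hmn)).2
    (h.ne_of_nextLock hm hmn) k' hk'
  exact ⟨f, hf, hfm.tail hmn⟩

theorem releasedBetween_of_nextLock_chain {a : M} {m c n d : Node N X V}
    (hm : t.HeldFrom p a m c) (hne : m ≠ n) (hnd : t.le n d)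
    (hmn : Relation.ReflTransGen (t.NextLock p a) m n) : t.ReleasedBetween p a c d := by
  rcases Relation.ReflTransGen.cases_head hmn with heq | ⟨m', ⟨q, hq, hqm'⟩, hm'n⟩
  · exact absurd heq hne
  obtain ⟨k, hk⟩ := hq.unlock
  have hqs := hq.self_eq.trans hm.self_eq
  have hm'n := (h.le_of_nextLock_chain (h.locked_target_mem hqm') hm'n).2
  exact ⟨k, q, hk, hqs, Nat.not_le.1 (hm.not_unlock k q hk hqs hq.idx_lt),
    le_trans (le_of_locked hqm') (le_trans hm'n hnd)⟩

theorem le_of_heldFrom {a : M} {m n : Node N X V} (hn : n ∈ t.nodes)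
    (hmn : t.HeldFrom p a m n) : t.le m n := by
  obtain ⟨k, hk⟩ := hmn.lock
  exact h.le_of_idx_le (h.edge_target_mem hk) hn hmn.self_eq hmn.idx_le

-- All acquisitions of `a` lie on the one chain of `NextLock` steps starting at its first
-- acquisition, hence any two of them are comparable.
theorem releasedBetween_or_releasedBetween {a : M} {c d : Node N X V} (hc : c ∈ t.nodes)
    (hd : d ∈ t.nodes) (hcd : c.st p.self ≠ d.st p.self) (hac : a ∈ t.lockset p c)
    (had : a ∈ t.lockset p d) : t.ReleasedBetween p a c d ∨ t.ReleasedBetween p a d c := by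
  obtain ⟨m, hm⟩ := mem_lockset_iff_exists_heldFrom.1 hac
  obtain ⟨n, hn⟩ := mem_lockset_iff_exists_heldFrom.1 had
  obtain ⟨f, hf, hfm⟩ := h.exists_nextLock_chain hm.lock
  obtain ⟨f', hf', hfn⟩ := h.exists_nextLock_chain hn.lock
  obtain rfl := h.locked_inj _ _ _ _ hf hf'
  have hne : m ≠ n := by
    rintro rfl
    exact hcd (hm.self_eq.symm.trans hn.self_eq)
  rcases Relation.ReflTransGen.total_of_right_unique h.nextLock_rightUnique hfm hfn with hmn | hnm
  · exact Or.inl (h.releasedBetween_of_nextLock_chain hm hne (h.le_of_heldFrom hd hn) hmn)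
  · exact Or.inr (h.releasedBetween_of_nextLock_chain hn hne.symm (h.le_of_heldFrom hc hm) hnm)

theorem releasedBetween_of_le {a : M} {c d : Node N X V} (hc : c ∈ t.nodes) (hd : d ∈ t.nodes)
    (hcd : c.st p.self ≠ d.st p.self) (hac : a ∈ t.lockset p c) (had : a ∈ t.lockset p d)
    (hle : t.le c d) : t.ReleasedBetween p a c d := by
  refine (h.releasedBetween_or_releasedBetween hc hd hcd hac had).resolve_right ?_
  rintro ⟨k, q, hq, hs, hi, hqc⟩
  have := (h.le_iff_idx_le (h.edge_target_mem hq) hd hs).1 (le_trans hqc hle)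
  omega

theorem le_of_releasedBetween {a : M} {c d : Node N X V} (hc : c ∈ t.nodes)
    (hcd : t.ReleasedBetween p a c d) : t.le c d := by
  obtain ⟨k, q, hq, hs, hi, hqd⟩ := hcd
  exact le_trans (h.le_of_idx_le hc (h.edge_target_mem hq) hs.symm hi.le) hqd

end IsGlobal

end Trace

/-! ### Sub-traces -/

namespace Trace

variable {N X G M L V : Type u} {p : Program N X G M L} {sem : Semantics N X G M L V}
  {t : Trace N X G M L V} {z : Node N X V}

theorem le_of_down_le {n a b : Node N X V} (hab : (t.down n).le a b) : t.le a b := by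
  refine Relation.ReflTransGen.mono ?_ _ _ hab
  rintro a b (⟨A, he⟩ | hc | ⟨c, hl⟩)
  · exact Or.inl ⟨A, he.1⟩
  · exact Or.inr (Or.inl hc.1)
  · exact Or.inr (Or.inr ⟨c, hl.1⟩)

theorem down_le_of_le {n a b : Node N X V} (hab : t.le a b) (hb : t.le b n) :
    (t.down n).le a b := by
  induction hab using Relation.ReflTransGen.head_induction_on with
  | refl => exact le_refl _
  | @head a c hstep hcb ih =>
    have hc : t.le c n := le_trans hcb hb
    have ha : t.le a n := Relation.ReflTransGen.head hstep hc
    refine Relation.ReflTransGen.head ?_ ih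
    rcases hstep with ⟨A, he⟩ | hcr | ⟨d, hl⟩
    · exact Or.inl ⟨A, he, ha, hc⟩
    · exact Or.inr (Or.inl ⟨hcr, ha, hc⟩)
    · exact Or.inr (Or.inr ⟨d, hl, ha, hc⟩)

theorem down_le_iff {n a b : Node N X V} (hb : t.le b n) : (t.down n).le a b ↔ t.le a b :=
  ⟨le_of_down_le, fun h => down_le_of_le h hb⟩

theorem down_down {m n : Node N X V} (hmn : t.le m n) : (t.down n).down m = t.down m := by
  have hone : ∀ {Q : Prop} {a}, (Q ∧ t.le a n) ∧ (t.down n).le a m ↔ Q ∧ t.le a m := by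
    intro Q a
    rw [down_le_iff hmn]
    exact ⟨fun ha => ⟨ha.1.1, ha.2⟩, fun ha => ⟨⟨ha.1, le_trans ha.2 hmn⟩, ha.2⟩⟩
  have htwo : ∀ {Q : Prop} {a b}, (Q ∧ t.le a n ∧ t.le b n) ∧ (t.down n).le a m ∧
      (t.down n).le b m ↔ Q ∧ t.le a m ∧ t.le b m := by
    intro Q a b
    rw [down_le_iff hmn, down_le_iff hmn]
    exact ⟨fun hab => ⟨hab.1.1, hab.2⟩,
      fun hab => ⟨⟨hab.1, le_trans hab.2.1 hmn, le_trans hab.2.2 hmn⟩, hab.2⟩⟩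
  exact Trace.mk.injEq .. |>.mpr ⟨Set.ext fun _ => hone, Set.ext fun _ => htwo,
    funext₂ fun _ _ => propext htwo, funext₃ fun _ _ _ => propext htwo⟩

theorem isSink_down {n : Node N X V} (hn : n ∈ t.nodes) : (t.down n).IsSink n :=
  ⟨⟨hn, le_refl n⟩, fun _ hk => down_le_of_le hk.2 (le_refl n)⟩

theorem mem_down_edges_iff {n m k : Node N X V} {A : Action N X G M L} :
    (m, A, k) ∈ (t.down n).edges ↔ (m, A, k) ∈ t.edges ∧ t.le k n :=
  ⟨fun he => ⟨he.1, he.2.2⟩, fun he => ⟨he.1, le_trans (le_of_edge he.1) he.2, he.2⟩⟩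

namespace IsThreading

variable {I : Set V} {r : V → RawTrace N X G M L V}

theorem node_mem (hr : t.IsThreading p sem I r) {i : V} (hi : i ∈ I) {j : ℕ}
    (hj : j ≤ (r i).len) : (r i).node j ∈ t.nodes :=
  (hr.mem_nodes_iff _).2 ⟨i, hi, j, hj, rfl⟩

theorem node_le_node (hr : t.IsThreading p sem I r) (h : t.IsGlobal p sem z) {i : V} (hi : i ∈ I)
    {j k : ℕ} (hjk : j ≤ k) (hk : k ≤ (r i).len) : t.le ((r i).node j) ((r i).node k) :=
  h.le_of_idx_le (hr.node_mem hi (hjk.trans hk)) (hr.node_mem hi hk)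
    (((hr.isRaw i hi).1 j (hjk.trans hk)).trans ((hr.isRaw i hi).1 k hk).symm) hjk

open scoped Classical in
theorem node_le_iff (hr : t.IsThreading p sem I r) (h : t.IsGlobal p sem z) {n : Node N X V}
    {i : V} (hi : i ∈ I) {j : ℕ} : j ≤ (r i).len ∧ t.le ((r i).node j) n ↔
      t.le ((r i).node 0) n ∧
        j ≤ Nat.findGreatest (fun k => t.le ((r i).node k) n) (r i).len := by
  constructor
  · rintro ⟨hj, hjn⟩
    exact ⟨le_trans (hr.node_le_node h hi (Nat.zero_le j) hj) hjn, Nat.le_findGreatest hj hjn⟩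
  · rintro ⟨h0, hj⟩
    have hlen := Nat.findGreatest_le (P := fun k => t.le ((r i).node k) n) (r i).len
    exact ⟨hj.trans hlen, le_trans (hr.node_le_node h hi hj hlen)
      (Nat.findGreatest_spec (P := fun k => t.le ((r i).node k) n) (Nat.zero_le _) h0)⟩

open scoped Classical in
theorem down (hr : t.IsThreading p sem I r) (h : t.IsGlobal p sem z) (n : Node N X V) :
    (t.down n).IsThreading p sem {i ∈ I | t.le ((r i).node 0) n} fun i =>
      { r i with len := Nat.findGreatest (fun j => t.le ((r i).node j) n) (r i).len } where
  finite := hr.finite.subset (Set.sep_subset _ _)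
  isRaw i hi := ⟨fun j hj => (hr.isRaw i hi.1).1 j (hj.trans (Nat.findGreatest_le _)),
    fun j hj => (hr.isRaw i hi.1).2 j (hj.trans_le (Nat.findGreatest_le _))⟩
  mem_nodes_iff k := by
    constructor
    · rintro ⟨hk, hkn⟩
      obtain ⟨i, hi, j, hj, rfl⟩ := (hr.mem_nodes_iff k).1 hk
      obtain ⟨h0, hj'⟩ := (hr.node_le_iff h hi).1 ⟨hj, hkn⟩
      exact ⟨i, ⟨hi, h0⟩, j, hj', rfl⟩
    · rintro ⟨i, ⟨hi, h0⟩, j, hj, rfl⟩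
      obtain ⟨hj', hjn⟩ := (hr.node_le_iff h hi).2 ⟨h0, hj⟩
      exact ⟨hr.node_mem hi hj', hjn⟩
  mem_edges_iff k A k' := by
    rw [mem_down_edges_iff]
    constructor
    · rintro ⟨he, hkn⟩
      obtain ⟨i, hi, j, hj, rfl, rfl, rfl⟩ := (hr.mem_edges_iff _ _ _).1 he
      obtain ⟨h0, hj'⟩ := (hr.node_le_iff h hi).1 ⟨hj, hkn⟩
      exact ⟨i, ⟨hi, h0⟩, j, hj', rfl, rfl, rfl⟩
    · rintro ⟨i, ⟨hi, h0⟩, j, hj, rfl, rfl, rfl⟩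
      obtain ⟨hj', hjn⟩ := (hr.node_le_iff h hi).2 ⟨h0, hj⟩
      exact ⟨(hr.mem_edges_iff _ _ _).2 ⟨i, hi, j, hj', rfl, rfl, rfl⟩, hjn⟩

end IsThreading

/-- `(m, g = x, k)` is the last write to `g` of the thread of `n`, up to `n`. -/
structure LastWriteAt (p : Program N X G M L) (t : Trace N X G M L V) (n : Node N X V) (g : G)
    (m : Node N X V) (x : X) (k : Node N X V) : Prop where
  write : (m, Action.write g x, k) ∈ t.edges
  self_eq : k.st p.self = n.st p.self
  idx_le : k.idx ≤ n.idx
  idx_le_of_write : ∀ l y l', (l, Action.write g y, l') ∈ t.edges → l'.st p.self = n.st p.self →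
    l'.idx ≤ n.idx → l'.idx ≤ k.idx

theorem lastWriteAt_of_write {m n : Node N X V} {g : G} {x : X}
    (he : (m, Action.write g x, n) ∈ t.edges) : t.LastWriteAt p n g m x n :=
  ⟨he, rfl, le_rfl, fun _ _ _ _ _ hi => hi⟩

namespace IsGlobal

variable (h : t.IsGlobal p sem z)
include h

theorem down_eq_self {s : Node N X V} (hs : t.IsSink s) : t.down s = t := by
  have hnode : ∀ {k}, k ∈ t.nodes → t.le k s := hs.2 _
  refine Trace.mk.injEq .. |>.mpr ⟨?_, ?_, ?_, ?_⟩
  · exact Set.ext fun k => and_iff_left_of_imp hnode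
  · exact Set.ext fun e => and_iff_left_of_imp fun he =>
      ⟨hnode (h.edge_source_mem he), hnode (h.edge_target_mem he)⟩
  · exact funext₂ fun k k' => propext (and_iff_left_of_imp fun hc =>
      ⟨hnode (h.created_dom _ _ hc).1, hnode (h.created_dom _ _ hc).2.1⟩)
  · exact funext₃ fun a k k' => propext (and_iff_left_of_imp fun hl =>
      ⟨hnode (h.locked_source_mem hl), hnode (h.locked_target_mem hl)⟩)

theorem down_lockset {n k : Node N X V} (hk : k ∈ t.nodes) (hkn : t.le k n) :
    (t.down n).lockset p k = t.lockset p k := by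
  have hedge : ∀ {m m' A}, (m, A, m') ∈ t.edges → m'.st p.self = k.st p.self → m'.idx ≤ k.idx →
      (m, A, m') ∈ (t.down n).edges := fun he hs hi =>
    mem_down_edges_iff.2 ⟨he, le_trans (h.le_of_idx_le (h.edge_target_mem he) hk hs hi) hkn⟩
  ext a
  constructor
  · rintro ⟨m, m', he, hs, hi, hno⟩
    exact ⟨m, m', he.1, hs, hi,
      fun l l' hl hls hli hle => hno l l' (hedge hl hls hle) hls hli hle⟩
  · rintro ⟨m, m', he, hs, hi, hno⟩
    exact ⟨m, m', hedge he hs hi, hs, hi, fun l l' hl => hno l l' hl.1⟩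

theorem down_isLastWrite_iff {n : Node N X V} (hn : n ∈ t.nodes) {g : G} {m k : Node N X V}
    {x : X} : (t.down n).IsLastWrite p n g m x k ↔ t.LastWriteAt p n g m x k := by
  have hle : ∀ {m m' A}, (m, A, m') ∈ t.edges → m'.st p.self = n.st p.self →
      (t.le m' n ↔ m'.idx ≤ n.idx) := fun he hs => h.le_iff_idx_le (h.edge_target_mem he) hn hs
  constructor
  · rintro ⟨he, hs, hmax⟩
    exact ⟨he.1, hs, (hle he.1 hs).1 he.2.2, fun l y l' hl hls hli =>
      hmax l y l' (mem_down_edges_iff.2 ⟨hl, (hle hl hls).2 hli⟩) hls⟩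
  · rintro ⟨he, hs, hi, hmax⟩
    exact ⟨mem_down_edges_iff.2 ⟨he, (hle he hs).2 hi⟩, hs, fun l y l' hl hls =>
      hmax l y l' hl.1 hls ((hle hl.1 hls).1 hl.2.2)⟩

theorem down {n : Node N X V} (hn : n ∈ t.nodes) : (t.down n).IsGlobal p sem z where
  raw := by
    obtain ⟨I, r, hr⟩ := h.exists_isThreading
    exact ⟨_, _, isThreading_iff.1 (hr.down h n)⟩
  enabled m A k he := by
    rw [h.down_lockset (h.edge_source_mem he.1) he.2.1]
    exact h.enabled m A k he.1
  init := ⟨⟨h.init.1, h.least n hn⟩, h.init.2⟩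
  least k hk := down_le_of_le (h.least k hk.1) hk.2
  antisymm m k hmk hkm := h.antisymm m k (le_of_down_le hmk) (le_of_down_le hkm)
  created_dom m s hc := by
    obtain ⟨hm, hs, h0, hz, hcreate, hcreates, hst⟩ := h.created_dom m s hc.1
    refine ⟨⟨hm, hc.2.1⟩, ⟨hs, hc.2.2⟩, h0, hz, hcreate, fun A k he => hcreates A k he.1, ?_⟩
    rwa [down_down hc.2.1]
  created_unique s hs h0 hz := by
    obtain ⟨m, hm, hu⟩ := h.created_unique s hs.1 h0 hz
    exact ⟨m, ⟨hm, le_trans (le_of_created hm) hs.2, hs.2⟩, fun m' hm' => hu m' hm'.1⟩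
  created_inj m s s' hs hs' := h.created_inj m s s' hs.1 hs'.1
  create_val m x v k he := by
    rw [down_down he.2.1]
    exact h.create_val m x v k he.1
  locked_dom a m k hl := by
    obtain ⟨hm, l, hk⟩ := h.locked_dom a m k hl.1
    refine ⟨hm.imp_right ?_, l, mem_down_edges_iff.2 ⟨hk, hl.2.2⟩⟩
    rintro ⟨l', hl'⟩
    exact ⟨l', mem_down_edges_iff.2 ⟨hl', hl.2.1⟩⟩
  locked_unique a k k' he := by
    obtain ⟨m, hm, hu⟩ := h.locked_unique a k k' he.1
    exact ⟨m, ⟨hm, le_trans (le_of_locked hm) he.2.2, he.2.2⟩, fun m' hm' => hu m' hm'.1⟩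
  locked_inj a m k k' hk hk' := h.locked_inj a m k k' hk.1 hk'.1
  read_val m x g k he := by
    obtain ⟨l, y, l', hl, hle, hmax, hval⟩ := h.read_val m x g k he.1
    exact ⟨l, y, l', mem_down_edges_iff.2 ⟨hl, le_trans hle he.2.1⟩, down_le_of_le hle he.2.1,
      fun w y' w' hw hwm hlw => hmax w y' w' hw.1 (le_of_down_le hwm) (le_of_down_le hlw), hval⟩

/-! ### Last writes -/

theorem lastWriteAt_unique {n : Node N X V} {g : G} {m m' k k' : Node N X V} {x x' : X}
    (hw : t.LastWriteAt p n g m x k) (hw' : t.LastWriteAt p n g m' x' k') :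
    m = m' ∧ x = x' ∧ k = k' := by
  obtain ⟨rfl, hA, rfl⟩ := h.edge_eq_of_idx_eq hw.write hw'.write
    (hw.self_eq.trans hw'.self_eq.symm)
    (le_antisymm (hw'.idx_le_of_write _ _ _ hw.write hw.self_eq hw.idx_le)
      (hw.idx_le_of_write _ _ _ hw'.write hw'.self_eq hw'.idx_le))
  exact ⟨rfl, by injection hA, rfl⟩

theorem lastWriteAt_step {m s : Node N X V} {A : Action N X G M L} (he : (m, A, s) ∈ t.edges)
    {g : G} (hA : ∀ x, A ≠ .write g x) {w k : Node N X V} {x : X} :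
    t.LastWriteAt p s g w x k ↔ t.LastWriteAt p m g w x k := by
  have hi := h.edge_idx he
  have hs := h.edge_self he
  constructor
  · rintro ⟨hw, hks, hki, hmax⟩
    exact ⟨hw, hks.trans hs.symm, h.idx_le_source_of_ne he hw (hA x).symm hks hki,
      fun l y l' hl hls hli => hmax l y l' hl (hls.trans hs) (by omega)⟩
  · rintro ⟨hw, hks, hki, hmax⟩
    exact ⟨hw, hks.trans hs, by omega, fun l y l' hl hls hli =>
      hmax l y l' hl (hls.trans hs.symm) (h.idx_le_source_of_ne he hl (hA y).symm hls hli)⟩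

end IsGlobal

end Trace

/-! ### Writes seen by reads -/

namespace Trace

variable {N X G M L V : Type u} {p : Program N X G M L} {sem : Semantics N X G M L V}
  {t : Trace N X G M L V} {z : Node N X V} {B : Set M} {g : G}

/-- `(k, g = y, k')` is a write to `g`, by any thread, which is maximal among those causally
before `m`. -/
structure MaxWrite (t : Trace N X G M L V) (m : Node N X V) (g : G) (k : Node N X V) (y : X)
    (k' : Node N X V) : Prop where
  write : (k, Action.write g y, k') ∈ t.edges
  le : t.le k' m
  eq_of_le : ∀ l y' l', (l, Action.write g y', l') ∈ t.edges → t.le l' m → t.le k' l' → l' = k'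

/-- The thread of `n` has written to `g`, and ever since, up to `n`, its lockset meets `B`. -/
def HeldSinceWrite (p : Program N X G M L) (t : Trace N X G M L V) (B : Set M) (n : Node N X V)
    (g : G) : Prop :=
  ∃ m x k, t.LastWriteAt p n g m x k ∧ ∀ l ∈ t.nodes, l.st p.self = n.st p.self →
    k.idx ≤ l.idx → l.idx ≤ n.idx → (t.lockset p l ∩ B).Nonempty

theorem HeldSinceWrite.lockset_inter_nonempty {n : Node N X V} (hg : t.HeldSinceWrite p B n g)
    (hn : n ∈ t.nodes) : (t.lockset p n ∩ B).Nonempty := by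
  obtain ⟨_, _, _, hw, hheld⟩ := hg
  exact hheld n hn rfl hw.idx_le le_rfl

namespace IsGlobal

variable (h : t.IsGlobal p sem z)
include h

theorem exists_maxWrite_of_read {m n : Node N X V} {x : X}
    (he : (m, Action.read x g, n) ∈ t.edges) :
    ∃ k y k', t.MaxWrite m g k y k' ∧ n.st x = k.st y := by
  obtain ⟨k, y, k', hk, hle, hmax, hval⟩ := h.read_val m x g n he
  exact ⟨k, y, k', ⟨hk, hle, hmax⟩, hval⟩

theorem subset_lockset_of_write {prot : G → Set M} (hprot : p.WriteProtects prot)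
    {m n : Node N X V} {x : X} (he : (m, Action.write g x, n) ∈ t.edges) :
    prot g ⊆ t.lockset p n := by
  rw [h.lockset_step he]
  exact hprot.2 _ _ _ _ _ (h.reach (h.edge_source_mem he)) (h.edge_mem_program he)

theorem lastWriteAt_of_maxWrite {m k k' n : Node N X V} {y : X} (hk : t.MaxWrite m g k y k')
    (hn : n ∈ t.nodes) (hnm : t.le n m) (hs : k'.st p.self = n.st p.self)
    (hi : k'.idx ≤ n.idx) : t.LastWriteAt p n g k y k' := by
  refine ⟨hk.write, hs, hi, fun l y' l' hl hls hli => ?_⟩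
  have hl' := h.edge_target_mem hl
  rcases Nat.le_total l'.idx k'.idx with hle | hle
  · exact hle
  · have hkl := h.le_of_idx_le (h.edge_target_mem hk.write) hl' (hs.trans hls.symm) hle
    rw [hk.eq_of_le l y' l' hl (le_trans (h.le_of_idx_le hl' hn hls hli) hnm) hkl]

theorem heldSinceWrite_step {m s : Node N X V} {A : Action N X G M L} (he : (m, A, s) ∈ t.edges)
    (hA : ∀ x, A ≠ .write g x) (hg : t.HeldSinceWrite p B m g)
    (hB : (t.lockset p s ∩ B).Nonempty) : t.HeldSinceWrite p B s g := by
  obtain ⟨w, x, k, hw, hheld⟩ := hg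
  refine ⟨w, x, k, (h.lastWriteAt_step he hA).2 hw, fun l hl hls hkl hli => ?_⟩
  by_cases hls' : l.idx = s.idx
  · rwa [h.node_ext hl (h.edge_target_mem he) hls hls']
  · have hi := h.edge_idx he
    exact hheld l hl (hls.trans (h.edge_self he).symm) hkl (by omega)

theorem heldSinceWrite_of_write {m n : Node N X V} {x : X}
    (he : (m, Action.write g x, n) ∈ t.edges) (hB : (t.lockset p n ∩ B).Nonempty) :
    t.HeldSinceWrite p B n g := by
  refine ⟨m, x, n, lastWriteAt_of_write he, fun l hl hls hnl hln => ?_⟩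
  rwa [h.node_ext hl (h.edge_target_mem he) hls (le_antisymm hln hnl)]

theorem exists_disjoint_lockset_of_le {c d : Node N X V} (hc : c ∈ t.nodes) (hd : d ∈ t.nodes)
    (hcd : c.st p.self ≠ d.st p.self) (hle : t.le c d) :
    ∃ b ∈ t.nodes, b.st p.self = c.st p.self ∧ c.idx ≤ b.idx ∧ t.le b d ∧
      Disjoint (t.lockset p b) (t.lockset p d) := by
  obtain ⟨b, ⟨hb, hbs, hbd⟩, hmax⟩ := Set.exists_max_image
    {b | b ∈ t.nodes ∧ b.st p.self = c.st p.self ∧ t.le b d} Node.idx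
    (h.finite_nodes.subset (Set.sep_subset _ _)) ⟨c, hc, rfl, hle⟩
  refine ⟨b, hb, hbs, hmax c ⟨hc, rfl, hle⟩, hbd, Set.disjoint_left.2 fun a hab had => ?_⟩
  obtain ⟨k, q, hq, hqs, hi, hqd⟩ :=
    h.releasedBetween_of_le hb hd (fun hs => hcd (hbs.symm.trans hs)) hab had hbd
  have := hmax q ⟨h.edge_target_mem hq, hqs.trans hbs, hqd⟩
  omega

theorem le_of_maxWrite {m k k' e e' : Node N X V} {x y : X} {a : M} (hm : m ∈ t.nodes)
    (hk : t.MaxWrite m g k y k') (he : t.LastWriteAt p m g e x e')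
    (hne : e'.st p.self ≠ k'.st p.self) (hae : a ∈ t.lockset p e') (hak : a ∈ t.lockset p k') :
    t.le e' k' := by
  have he' := h.edge_target_mem he.write
  have hk' := h.edge_target_mem hk.write
  rcases h.releasedBetween_or_releasedBetween he' hk' hne hae hak with hrel | hrel
  · exact h.le_of_releasedBetween he' hrel
  · rw [hk.eq_of_le e x e' he.write (h.le_of_idx_le he' hm he.self_eq he.idx_le)
      (h.le_of_releasedBetween hk' hrel)]
    exact le_refl k'

theorem self_eq_of_maxWrite {m k k' : Node N X V} {y : X} (hm : m ∈ t.nodes)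
    (hk : t.MaxWrite m g k y k') (hB : B ⊆ t.lockset p k') (hg : t.HeldSinceWrite p B m g) :
    k'.st p.self = m.st p.self := by
  by_contra hne
  obtain ⟨e, x, e', he, hheld⟩ := hg
  have hk' := h.edge_target_mem hk.write
  have he' := h.edge_target_mem he.write
  have hne' : e'.st p.self ≠ k'.st p.self := fun hs => hne (hs.symm.trans he.self_eq)
  obtain ⟨a, hae, haB⟩ := hheld e' he' he.self_eq le_rfl he.idx_le
  have hle : t.le e' k' := h.le_of_maxWrite hm hk he hne' hae (hB haB)
  obtain ⟨c, hc, hcs, hec, hck, hdisj⟩ := h.exists_disjoint_lockset_of_le he' hk' hne' hle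
  have hcm := hcs.trans he.self_eq
  obtain ⟨b, hbc, hbB⟩ := hheld c hc hcm hec
    ((h.le_iff_idx_le hc hm hcm).1 (le_trans hck hk.le))
  exact Set.disjoint_left.1 hdisj hbc (hB hbB)

end IsGlobal

end Trace

/-! ### Soundness of Protection-Based Reading -/

section Soundness

variable {N X G M L V D : Type u} {p : Program N X G M L} {sem : Semantics N X G M L V}
  {t : Trace N X G M L V} {z : Node N X V} {prot : G → Set M} {conc : D → Set V}

/-- The local trace ending in the node `n` of `t` is described by `q`, expressed through the nodes
of `t` instead of those of its sub-trace `t.down n`. -/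
structure DescribedAt (p : Program N X G M L) (prot : G → Set M) (conc : D → Set V)
    (t : Trace N X G M L V) (n : Node N X V) (q : PState X G D) : Prop where
  locals : ∀ x, n.st x ∈ conc (q.2 (Sum.inl x))
  globals : ∀ g m x k, t.LastWriteAt p n g m x k → m.st x ∈ conc (q.2 (Sum.inr g))
  held : ∀ g ∈ OrderDual.ofDual q.1, t.HeldSinceWrite p (prot g) n g

theorem DescribedAt.mono [Preorder D] (hconc : Monotone conc) {n : Node N X V}
    {q q' : PState X G D} (hd : DescribedAt p prot conc t n q) (hq : q ≤ q') :
    DescribedAt p prot conc t n q' :=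
  ⟨fun x => hconc (hq.2 _) (hd.locals x), fun g m x k hw => hconc (hq.2 _) (hd.globals g m x k hw),
    fun g hg => hd.held g (hq.1 hg)⟩

section Down

variable (h : t.IsGlobal p sem z) {n : Node N X V} {q : PState X G D}
include h

theorem betaW_down_le_gammaState (hprot : p.WriteProtects prot) :
    betaW p (t.down n) n ≤ (gammaState prot q).1 := by
  refine fun g => upLocks_le_iff.2 ?_
  rintro _ ⟨m, x, k, hw, rfl⟩
  rw [upMem_gammaState_fst, h.down_lockset (h.edge_target_mem hw.1.1) hw.1.2.2]
  exact h.subset_lockset_of_write hprot hw.1.1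

variable (hn : n ∈ t.nodes)
include hn

theorem DescribedAt.betaP_down_le (hd : DescribedAt p prot conc t n q) :
    betaP p (t.down n) n ≤ (gammaState prot q).2.1 := by
  refine fun g => upLocks_le_iff.2 ?_
  rintro _ (⟨m, x, k, hw, l, ⟨hl, hln⟩, hs, hi, rfl⟩ | ⟨hno, rfl⟩) <;>
    refine upMem_gammaState_snd.2 fun hg => ?_ <;>
    obtain ⟨m', x', k', hw', hheld⟩ := hd.held g hg
  · obtain ⟨-, -, rfl⟩ := h.lastWriteAt_unique ((h.down_isLastWrite_iff hn).1 hw) hw'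
    rw [h.down_lockset hl hln]
    exact hheld l hl hs hi ((h.le_iff_idx_le hl hn hs).1 hln)
  · exact absurd ⟨m', x', k', (h.down_isLastWrite_iff hn).2 hw'⟩ hno

theorem DescribedAt.betaStore_down_subset (hd : DescribedAt p prot conc t n q) (y : X ⊕ G) :
    betaStore p (t.down n) n y ⊆ conc (q.2 y) := by
  rcases y with x | g
  · rintro _ rfl
    exact hd.locals x
  · rintro _ ⟨m, x, k, hw, rfl⟩
    exact hd.globals g m x k ((h.down_isLastWrite_iff hn).1 hw)

theorem DescribedAt.down_mem_gammaAt (hprot : p.WriteProtects prot)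
    (hd : DescribedAt p prot conc t n q) :
    t.down n ∈ gammaAt p sem conc n.pt (t.lockset p n) (gammaState prot q) := by
  have hsink := Trace.isSink_down hn
  exact ⟨⟨⟨z, h.down hn⟩, n, hsink⟩, n, hsink, rfl, h.down_lockset hn (Trace.le_refl n),
    betaW_down_le_gammaState h hprot, hd.betaP_down_le h hn, hd.betaStore_down_subset h hn⟩

end Down

section Step

variable (h : t.IsGlobal p sem z)
include h

theorem DescribedAt.of_idx_zero {n : Node N X V} (h0 : n.idx = 0) {σ : Store X G D}
    (hX : ∀ x, n.st x ∈ conc (σ (Sum.inl x))) :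
    DescribedAt p prot conc t n (OrderDual.toDual ∅, σ) := by
  refine ⟨hX, fun g m x k hw => ?_, fun g hg => absurd hg (Set.notMem_empty g)⟩
  have hk := h.edge_idx hw.write
  have hkn := hw.idx_le
  omega

theorem DescribedAt.step {m s : Node N X V} {A : Action N X G M L} (he : (m, A, s) ∈ t.edges)
    (hA : ∀ g x, A ≠ .write g x) {q q' : PState X G D} (hd : DescribedAt p prot conc t m q)
    (hX : ∀ x, s.st x ∈ conc (q'.2 (Sum.inl x)))
    (hG : ∀ g, q'.2 (Sum.inr g) = q.2 (Sum.inr g))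
    (hP : ∀ g ∈ OrderDual.ofDual q'.1, g ∈ OrderDual.ofDual q.1 ∧
      (t.lockset p s ∩ prot g).Nonempty) : DescribedAt p prot conc t s q' := by
  refine ⟨hX, fun g w x k hw => ?_, fun g hg => ?_⟩
  · rw [hG]
    exact hd.globals g w x k ((h.lastWriteAt_step he (hA g)).1 hw)
  · exact h.heldSinceWrite_step he (hA g) (hd.held g (hP g hg).1) (hP g hg).2

theorem DescribedAt.step_of_lockset_subset {m s : Node N X V} {A : Action N X G M L}
    (he : (m, A, s) ∈ t.edges) (hA : ∀ g x, A ≠ .write g x)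
    (hS : t.lockset p m ⊆ t.lockset p s) {q : PState X G D} {σ : Store X G D}
    (hd : DescribedAt p prot conc t m q) (hX : ∀ x, s.st x ∈ conc (σ (Sum.inl x)))
    (hG : ∀ g, σ (Sum.inr g) = q.2 (Sum.inr g)) :
    DescribedAt p prot conc t s (q.1, σ) :=
  hd.step h he hA hX hG fun g hg => ⟨hg, ((hd.held g hg).lockset_inter_nonempty
    (h.edge_source_mem he)).mono (Set.inter_subset_inter_left _ hS)⟩

theorem DescribedAt.write (hprot : p.WriteProtects prot) {m s : Node N X V} {g : G} {x : X}
    (he : (m, Action.write g x, s) ∈ t.edges) {q : PState X G D}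
    (hd : DescribedAt p prot conc t m q) :
    DescribedAt p prot conc t s (OrderDual.toDual (OrderDual.ofDual q.1 ∪ {g}),
      override q.2 (Sum.inr g) (q.2 (Sum.inl x))) := by
  have hst : s.st = m.st := h.edge_localStep he
  have hA : ∀ {g'}, g' ≠ g → ∀ y, (Action.write g x : Action N X G M L) ≠ .write g' y := by
    intro g' hg' y hy
    injection hy with hy
    exact hg' hy.symm
  refine ⟨fun y => ?_, fun g' w y k hw => ?_, fun g' hg' => ?_⟩
  · rw [hst]
    change m.st y ∈ conc (override q.2 _ _ _)
    rw [override_of_ne Sum.inl_ne_inr]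
    exact hd.locals y
  · change w.st y ∈ conc (override q.2 _ _ _)
    by_cases hgg : g' = g
    · subst hgg
      obtain ⟨rfl, rfl, rfl⟩ := h.lastWriteAt_unique hw (Trace.lastWriteAt_of_write he)
      rw [override_same]
      exact hd.locals y
    · rw [override_of_ne (Sum.inr_injective.ne hgg)]
      exact hd.globals g' w y k ((h.lastWriteAt_step he (hA hgg)).1 hw)
  · by_cases hgg : g' = g
    · subst hgg
      exact h.heldSinceWrite_of_write he
        ⟨p.mtx g', h.subset_lockset_of_write hprot he (hprot.1 g'), hprot.1 g'⟩
    · have hheld := hd.held g' (hg'.resolve_right hgg)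
      refine h.heldSinceWrite_step he (hA hgg) hheld ?_
      rw [h.lockset_step he]
      exact hheld.lockset_inter_nonempty (h.edge_source_mem he)

end Step

theorem override_mem_conc {ρ : X → V} {σ : X → D} (hρ : ∀ y, ρ y ∈ conc (σ y)) {v : V} {d : D}
    (hv : v ∈ conc d) (x y : X) : override ρ x v y ∈ conc (override σ x d y) := by
  by_cases hy : y = x
  · subst hy
    rwa [override_same, override_same]
  · rw [override_of_ne hy, override_of_ne hy]
    exact hρ y

theorem override_inl {σ : Store X G D} {x : X} {d : D} (y : X) :
    override σ (Sum.inl x) d (Sum.inl y) = override (fun y => σ (Sum.inl y)) x d y := by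
  by_cases hy : y = x
  · subst hy
    rw [override_same, override_same]
  · rw [override_of_ne hy, override_of_ne (Sum.inl_injective.ne hy)]

variable [CompleteLattice D] {comp : L → (X → D) → (X → D)} {nu : N → PState X G D → N → D}
  {η : PAssign N X G M D}

/-- The node `n` of `t` is described by the value which `η` assigns to its unknown. -/
def IsDescribed (p : Program N X G M L) (prot : G → Set M) (conc : D → Set V)
    (η : PAssign N X G M D) (t : Trace N X G M L V) (n : Node N X V) : Prop :=
  DescribedAt p prot conc t n (η (.pt n.pt (t.lockset p n)))

section Solution

variable (hη : IsSolution (C₁' p prot comp nu) η) (h : t.IsGlobal p sem z)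
include hη h

theorem IsSolution.covers_and_le_of_edge {m n : Node N X V} {A : Action N X G M L}
    (he : (m, A, n) ∈ t.edges) :
    Covers η (pRhs p prot comp nu (unlockEff' p prot) m.pt (t.lockset p m) A η).1 ∧
      (pRhs p prot comp nu (unlockEff' p prot) m.pt (t.lockset p m) A η).2 ≤
        (η (.pt n.pt (t.lockset p n)) : PState X G D) := by
  rw [h.lockset_step he]
  exact (isSolution_pSystem_iff.1 hη).2 _ _ _ _ (h.reach (h.edge_source_mem he))
    (h.edge_mem_program he) (h.enabled _ _ _ he)

section Read

variable (hatomic : p.Atomic) (hconc : Monotone conc) {m k k' : Node N X V} {g : G} {y : X}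

include hatomic hconc in
theorem IsSolution.write_mem_conc_glob' (hk : (k, Action.write g y, k') ∈ t.edges)
    (hd : IsDescribed p prot conc η t k') {n : Node N X V} (hn : n ∈ t.nodes)
    (hs : k'.st p.self = n.st p.self) (hi : k'.idx < n.idx) :
    k.st y ∈ conc (η (.glob' g)) := by
  obtain ⟨A, k'', he⟩ := h.exists_edge_from (h.edge_target_mem hk) hn hs hi
  obtain rfl := hatomic.after _ _ _ g (h.edge_mem_program hk) (Or.inl ⟨y, rfl⟩) _ _
    (h.edge_mem_program he)
  have hcov := (hη.covers_and_le_of_edge h he).1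
  exact hconc ((covers_unlockEff'_iff.1 hcov).2.2 g (Or.inl ⟨g, rfl⟩))
    (hd.globals g k y k' (Trace.lastWriteAt_of_write hk))

include hconc in
theorem IsSolution.lastWriteAt_mem_conc_glob {l l' : Node N X V} {b : M}
    (he : (l, Action.unlock b, l') ∈ t.edges) (hb : b ∈ prot g \ {p.mtx g})
    (hd : IsDescribed p prot conc η t l) (hw : t.LastWriteAt p l g k y k') :
    k.st y ∈ conc (η (.glob g)) := by
  have hcov := (hη.covers_and_le_of_edge h he).1
  exact hconc ((covers_unlockEff'_iff.1 hcov).1 g fun hsub => (hsub hb).2 rfl)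
    (hd.globals g k y k' hw)

variable (hprot : p.WriteProtects prot) (hm : m ∈ t.nodes) (hk : t.MaxWrite m g k y k')
  (hmg : p.mtx g ∈ t.lockset p m)
  (ih : ∀ n ∈ t.nodes, t.le n m → IsDescribed p prot conc η t n)
include hatomic hconc hprot hm hk hmg ih

theorem IsSolution.maxWrite_mem_conc_of_ne (hs : k'.st p.self ≠ m.st p.self) :
    k.st y ∈ conc (if t.lockset p m ∩ prot g = {p.mtx g} then (η (.glob' g) : D)
      else η (.glob g)) := by
  have hk' := h.edge_target_mem hk.write
  have hprotk := h.subset_lockset_of_write hprot hk.write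
  split_ifs with hS
  · obtain ⟨l, q, hq, hqs, hi, -⟩ :=
      h.releasedBetween_of_le hk' hm hs (hprotk (hprot.1 g)) hmg hk.le
    exact hη.write_mem_conc_glob' h hatomic hconc hk.write (ih k' hk' hk.le)
      (h.edge_target_mem hq) hqs.symm hi
  · obtain ⟨b, ⟨hbm, hb⟩, hbg⟩ : ∃ b ∈ t.lockset p m ∩ prot g, b ≠ p.mtx g := by
      by_contra! hall
      exact hS (Set.eq_singleton_iff_unique_mem.2 ⟨⟨hmg, hprot.1 g⟩, hall⟩)
    obtain ⟨l, q, hq, hqs, hi, hqm⟩ := h.releasedBetween_of_le hk' hm hs (hprotk hb) hbm hk.le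
    have hl := h.edge_source_mem hq
    have hlm := Trace.le_trans (Trace.le_of_edge hq) hqm
    refine hη.lastWriteAt_mem_conc_glob h hconc hq ⟨hb, hbg⟩ (ih l hl hlm)
      (h.lastWriteAt_of_maxWrite hk hl hlm (hqs.symm.trans (h.edge_self hq).symm) ?_)
    have := h.edge_idx hq
    omega

theorem IsSolution.maxWrite_mem_conc_pRead :
    k.st y ∈ conc (pRead p prot η (t.lockset p m) (η (.pt m.pt (t.lockset p m))) g) := by
  have hd := ih m hm (Trace.le_refl m)
  have hk' := h.edge_target_mem hk.write
  by_cases hs : k'.st p.self = m.st p.self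
  · exact hconc le_pRead (hd.globals g k y k' (h.lastWriteAt_of_maxWrite hk hm (Trace.le_refl m) hs
      ((h.le_iff_idx_le hk' hm hs).1 hk.le)))
  · have hg : g ∉ OrderDual.ofDual (η (.pt m.pt (t.lockset p m)) : PState X G D).1 := fun hg =>
      hs (h.self_eq_of_maxWrite hm hk (h.subset_lockset_of_write hprot hk.write) (hd.held g hg))
    refine hconc ?_ (hη.maxWrite_mem_conc_of_ne h hatomic hconc hprot hm hk hmg ih hs)
    unfold pRead
    rw [if_neg hg]
    split_ifs <;> exact le_sup_right

end Read

end Solution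

theorem isDescribed_init (hs : SoundIngredients p sem prot conc comp nu)
    (hη : IsSolution (C₁' p prot comp nu) η) (h : t.IsGlobal p sem z) :
    IsDescribed p prot conc η t z := by
  obtain ⟨-, h0, hstart, -⟩ := h.init
  unfold IsDescribed
  rw [h.lockset_of_idx_zero h0, hstart]
  refine (DescribedAt.of_idx_zero h h0 fun x => ?_).mono hs.conc_mono
    (isSolution_pSystem_iff.1 hη).1
  exact hs.conc_top ▸ Set.mem_univ (z.st x)

section Edge

variable (hs : SoundIngredients p sem prot conc comp nu) (hatomic : p.Atomic)
  (hprot : p.WriteProtects prot) (hη : IsSolution (C₁' p prot comp nu) η) (h : t.IsGlobal p sem z)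
  {m n : Node N X V}
include hs hprot h

theorem DescribedAt.create {x : X} {u₁ : N} (he : (m, Action.create x u₁, n) ∈ t.edges)
    {q : PState X G D} (hd : DescribedAt p prot conc t m q) :
    DescribedAt p prot conc t n (q.1, override q.2 (Sum.inl x) (nu m.pt q u₁)) := by
  refine hd.step_of_lockset_subset h he nofun (h.lockset_step he).ge (fun y => ?_)
    fun g => override_of_ne Sum.inr_ne_inl
  rw [h.create_val _ _ _ _ he, override_inl]
  exact override_mem_conc hd.locals (hs.nu_sound _ _ _ _ _ _ (h.edge_mem_program he) _
    (hd.down_mem_gammaAt h (h.edge_source_mem he) hprot)) x y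

include hη

theorem IsDescribed.of_created (hc : t.created m n) (hd : IsDescribed p prot conc η t m) :
    IsDescribed p prot conc η t n := by
  obtain ⟨hm, -, h0, -, ⟨x, v, he⟩, -, hst⟩ := h.created_dom m n hc
  have hcov := ((isSolution_pSystem_iff.1 hη).2 _ _ _ _ (h.reach hm) he trivial).1
  unfold IsDescribed
  rw [h.lockset_of_idx_zero h0]
  refine (DescribedAt.of_idx_zero h h0 fun y => ?_).mono hs.conc_mono (covers_singleton.1 hcov)
  rw [hst]
  exact override_mem_conc hd.locals
    (hs.nu_sound _ _ _ _ _ _ he _ (hd.down_mem_gammaAt h hm hprot)) p.self y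

include hatomic

theorem DescribedAt.read {x : X} {g : G} (he : (m, Action.read x g, n) ∈ t.edges)
    (ih : ∀ k ∈ t.nodes, t.le k m → IsDescribed p prot conc η t k) {q : PState X G D}
    (hq : q = η (.pt m.pt (t.lockset p m))) :
    DescribedAt p prot conc t n
      (q.1, override q.2 (Sum.inl x) (pRead p prot η (t.lockset p m) q g)) := by
  subst hq
  have hm := h.edge_source_mem he
  have hd := ih m hm (Trace.le_refl m)
  obtain ⟨d, hst⟩ : ∃ d, n.st = override m.st x d := h.edge_localStep he
  obtain ⟨k, y, k', hk, hval⟩ := h.exists_maxWrite_of_read he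
  have hmg := (h.reach hm).mtx_mem_of_accesses hatomic (h.edge_mem_program he) (Or.inr ⟨x, rfl⟩)
  refine hd.step_of_lockset_subset h he nofun (h.lockset_step he).ge (fun y => ?_)
    fun g => override_of_ne Sum.inr_ne_inl
  rw [hst, override_same] at hval
  rw [hst, hval, override_inl]
  exact override_mem_conc hd.locals
    (hη.maxWrite_mem_conc_pRead h hatomic hs.conc_mono hprot hm hk hmg ih) x y

theorem IsDescribed.of_edge {A : Action N X G M L} (he : (m, A, n) ∈ t.edges)
    (ih : ∀ k ∈ t.nodes, t.le k m → IsDescribed p prot conc η t k) :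
    IsDescribed p prot conc η t n := by
  have hd := ih m (h.edge_source_mem he) (Trace.le_refl m)
  refine DescribedAt.mono hs.conc_mono ?_ (hη.covers_and_le_of_edge h he).2
  have hst := h.edge_localStep he
  have hS := h.lockset_step he
  cases A with
  | comp l =>
    exact hd.step_of_lockset_subset h he nofun hS.ge (hs.comp_sound l _ _ _ hd.locals hst)
      fun _ => rfl
  | create x u₁ => exact hd.create hs hprot h he
  | lock a =>
    refine hd.step_of_lockset_subset h he nofun (Set.subset_union_left.trans hS.ge) ?_
      fun _ => rfl
    exact hst ▸ hd.locals
  | unlock a =>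
    refine hd.step h he nofun ?_ (fun _ => rfl) fun g hg => ⟨hg.1, hS ▸ hg.2⟩
    exact hst ▸ hd.locals
  | write g x => exact hd.write h hprot he
  | read x g => exact DescribedAt.read hs hatomic hprot hη h he ih rfl

theorem isDescribed : ∀ n ∈ t.nodes, IsDescribed p prot conc η t n := by
  refine h.node_induction fun n hn ih => ?_
  by_cases h0 : n.idx = 0
  · by_cases hz : n = z
    · exact hz ▸ isDescribed_init hs hη h
    · obtain ⟨m, hm, -⟩ := h.created_unique n hn h0 hz
      exact .of_created hs hprot hη h hm
        (ih m (h.created_dom m n hm).1 (Trace.le_of_created hm) (h.created_ne hm))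
  · obtain ⟨m, A, he⟩ := h.exists_edge_to hn h0
    have hmn := Trace.le_of_edge he
    refine .of_edge hs hatomic hprot hη h he fun k hk hkm =>
      ih k hk (Trace.le_trans hkm hmn) ?_
    rintro rfl
    exact h.edge_source_ne he (h.antisymm _ _ hmn hkm)

end Edge

section SoundFor

variable (hs : SoundIngredients p sem prot conc comp nu) (hatomic : p.Atomic)
  (hprot : p.WriteProtects prot) (hη : IsSolution (C₁' p prot comp nu) η)
include hs hatomic hprot hη

theorem tracesAt_subset_gammaAt {u : N} {S : Set M} :
    tracesAt p sem u S ⊆ gammaAt p sem conc u S (gammaState prot (η (.pt u S))) := by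
  rintro t ⟨⟨⟨z, h⟩, -⟩, s, hsink, rfl, rfl⟩
  have := (isDescribed hs hatomic hprot hη h s hsink.1).down_mem_gammaAt h hsink.1 hprot
  rwa [h.down_eq_self hsink] at this

theorem tracesGlob_subset_gammaGlob {g : G} {a : M} {S w : Set M} {d : D}
    (hd : ∀ T σ, S = T \ {a} → Covers η (unlockEff' p prot T a σ) → σ (Sum.inr g) ≤ d) :
    tracesGlob p sem g a S w ⊆ gammaGlob p sem conc g a S w d := by
  rintro t ⟨⟨⟨z, h⟩, hsk⟩, s, hsink, ⟨m, he⟩, hS, hw⟩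
  refine ⟨⟨⟨z, h⟩, hsk⟩, s, hsink, ⟨m, he⟩, hS, fun k x k' hlast => ⟨?_, hw k x k' hlast⟩⟩
  rw [← h.down_eq_self hsink, h.down_isLastWrite_iff hsink.1, h.lastWriteAt_step he nofun] at hlast
  exact hs.conc_mono (hd _ _ (hS.symm.trans (h.lockset_step he)) (hη.covers_and_le_of_edge h he).1)
    ((isDescribed hs hatomic hprot hη h m (h.edge_source_mem he)).globals g k x k' hlast)

theorem soundFor_of_isSolution : SoundFor p sem prot conc η :=
  ⟨fun _ _ => tracesAt_subset_gammaAt hs hatomic hprot hη,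
    fun _ _ _ _ hdesc => tracesGlob_subset_gammaGlob hs hatomic hprot hη fun _ _ hS hcov =>
      hcov.le_glob_of_describes (hS ▸ hdesc),
    fun _ _ _ _ hdesc => tracesGlob_subset_gammaGlob hs hatomic hprot hη fun _ _ hS hcov =>
      hcov.le_glob'_of_describes (hS ▸ hdesc)⟩

end SoundFor

end Soundness

end ConcurrentAnalysis

open ConcurrentAnalysis in
theorem theorem7_general {N X G M L D : Type u} [CompleteLattice D]
    (p : Program N X G M L) (prot : G → Set M) (comp : L → (X → D) → (X → D))
    (nu₁ : N → PState X G D → N → D) (nu₃ : N → WState X G M D → N → D)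
    (hatomic : p.Atomic) (hprot : p.WriteProtects prot) (hcomp : ∀ l, Monotone (comp l))
    (hnu₁ : ∀ u u₁, Monotone fun q => nu₁ u q u₁)
    (hnu : ∀ u q u₁, nu₃ u (gammaState prot q) u₁ ≤ nu₁ u q u₁) :
    ∃ η : PAssign N X G M D,
      IsLeastSolution (C₁' p prot comp nu₁) η ∧ IsLeastSolution (C₁ p prot comp nu₁) η ∧
      (∀ g, (η (.glob g) : D) ≤ η (.glob' g)) ∧
      IsSolution (C₃ p comp nu₃) (eta₃ p prot η) ∧
      (∀ g a S w, Describes p prot (.glob g a S w) (.glob' g : PUnk N G M) →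
        (eta₃ p prot η (.glob g a S w) : D) ≤ η (.glob' g)) ∧
      (∀ g a S w, Describes p prot (.glob g a S w) (.glob g : PUnk N G M) →
        (eta₃ p prot η (.glob g a S w) : D) ≤ η (.glob g)) ∧
      (∀ (V : Type u) (sem : Semantics N X G M L V) (conc : D → Set V),
        SoundIngredients p sem prot conc comp nu₁ → SoundFor p sem prot conc η) := by
  obtain ⟨η, hη⟩ := exists_isLeastSolution (C₁_mono (p := p) (prot := prot) hcomp hnu₁)
    PVal.exists_isGLB
  have hsol : IsSolution (C₁' p prot comp nu₁) η := hη.isSolution_C₁' hcomp hnu₁ hatomic hprot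
  have hle := hη.glob_le_glob' hcomp hnu₁ hatomic
  refine ⟨η, ⟨hsol, fun ζ hζ => hη.2 hζ.C₁_of_C₁'⟩, hη, hle, hsol.eta₃ hatomic hprot hnu hle,
    fun g a S w hd => (eta₃_eq_of_describes_glob' hd).le,
    fun g a S w hd => (eta₃_eq_of_describes_glob hd).le,
    fun V sem conc hs => soundFor_of_isSolution hs hatomic hprot hsol⟩

theorem theorem7 {N X G M L D : Type u} [Finite M] [CompleteLattice D]
    (p : ConcurrentAnalysis.Program N X G M L) (prot : G → Set M)
    (comp : L → (X → D) → (X → D))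
    (nu₁ : N → ConcurrentAnalysis.PState X G D → N → D)
    (nu₃ : N → ConcurrentAnalysis.WState X G M D → N → D)
    (hatomic : p.Atomic) (hprot : p.WriteProtects prot)
    (hcomp : ∀ l, Monotone (comp l))
    (hnu₁ : ∀ u u₁, Monotone fun q => nu₁ u q u₁)
    (hnu : ∀ u q u₁, nu₃ u (ConcurrentAnalysis.gammaState prot q) u₁ ≤ nu₁ u q u₁) :
    ∃ η : ConcurrentAnalysis.PAssign N X G M D,
      ConcurrentAnalysis.IsLeastSolution (ConcurrentAnalysis.C₁' p prot comp nu₁) η ∧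
      ConcurrentAnalysis.IsLeastSolution (ConcurrentAnalysis.C₁ p prot comp nu₁) η ∧
      (∀ g, (η (.glob g) : D) ≤ η (.glob' g)) ∧
      ConcurrentAnalysis.IsSolution (ConcurrentAnalysis.C₃ p comp nu₃)
        (ConcurrentAnalysis.eta₃ p prot η) ∧
      (∀ g a S w, ConcurrentAnalysis.Describes p prot (.glob g a S w)
          (.glob' g : ConcurrentAnalysis.PUnk N G M) →
        (ConcurrentAnalysis.eta₃ p prot η (.glob g a S w) : D) ≤ η (.glob' g)) ∧
      (∀ g a S w, ConcurrentAnalysis.Describes p prot (.glob g a S w)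
          (.glob g : ConcurrentAnalysis.PUnk N G M) →
        (ConcurrentAnalysis.eta₃ p prot η (.glob g a S w) : D) ≤ η (.glob g)) ∧
      (∀ (V : Type u) (sem : ConcurrentAnalysis.Semantics N X G M L V) (conc : D → Set V),
        ConcurrentAnalysis.SoundIngredients p sem prot conc comp nu₁ →
        ConcurrentAnalysis.SoundFor p sem prot conc η) :=
  theorem7_general p prot comp nu₁ nu₃ hatomic hprot hcomp hnu₁ hnu
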